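/- Let $M$ be a finite von Neumann algebra with faithful normal trace $\tau$, acting on $L_2(M)=L_2(M,\tau)$ with cyclic vector $\Omega_\tau$. Let $(\Phi_t)_{t\ge 0}$ be a quantum Markov semi-group on $(M,\tau)$: a semi-group ($\Phi_0=\mathrm{id}$, $\Phi_{s+t}=\Phi_s\Phi_t$) of unital completely positive maps with $\tau\circ\Phi_t=\tau$ and $\tau(\Phi_t(x)y)=\tau(x\Phi_t(y))$, such that $t\mapsto\Phi_t(x)$ is strongly continuous for every $x\in M$. Let $\Delta\ge 0$ be its generator on $L_2(M)$, so that $e^{-t\Delta}(x\Omega_\tau)=\Phi_t(x)\Omega_\tau$. Let $\mathcal A\subseteq M$ be a $\sigma$-weakly dense $*$-subalgebra such that $\mathcal A\Omega_\tau\subseteq\mathrm{dom}(\Delta)$, $\Delta(\mathcal A\Omega_\tau)\subseteq\mathcal A\Omega_\tau$, and $t\mapsto\Phi_t(a)$ is norm continuous for all $a\in\mathcal A$; write $\Delta(a)\in\mathcal A$ for the element with $\Delta(a)\Omega_\tau=\Delta(a\Omega_\tau)$. Put $\Gamma(x,y)=\frac12(\Delta(y)^*x+y^*\Delta(x)-\Delta(y^*x))$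 for $x,y\in\mathcal A$, and let $L_2(M)_\nabla$ be the Hilbert space obtained from $\mathcal A\otimes_{\mathrm{alg}}L_2(M)$ with $\langle x\otimes\xi,y\otimes\eta\rangle=\langle\Gamma(x,y)\xi,\eta\rangle$ by separation and completion, $x\otimes_\nabla\xi$ being the class of $x\otimes\xi$. It carries bounded commuting left and right actions of $\mathcal A$ determined by $x\cdot(y\otimes_\nabla\xi)=xy\otimes_\nabla\xi-x\otimes_\nabla y\xi$ and $(y\otimes_\nabla\xi)\cdot x=y\otimes_\nabla\xi x$. Let $\partial:\mathcal A\to L_2(M)_\nabla$ be the derivation $\partial(a)=a\otimes_\nabla\Omega_\tau$. Assume that $\Delta$ is filtered: it has compact resolvent; its eigenvalues form a strictly increasing sequence $\lambda_0<\lambda_1<\cdots$; for each $n$ there is a (necessarily unique) subspace $\mathcal A(\lambda_n)\subseteq\mathcal A$ such that $\mathcal A(\lambda_n)\Omega_\tau$ is the eigenspace of $\Delta$ at $\lambda_n$; and $\mathcal A=\bigoplus_{k\ge 0}\mathcal A(\lambda_k)$ (algebraic direct sum) with $\mathcal A(\lambda_n)\mathcal A(\lambda_m)\subseteq\bigoplus_{k=0}^{n+m}\mathcal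 A(\lambda_k)$ for all $n,m$. Assume moreover that $\Delta$ has subexponential growth: $\lim_{n\to\infty}\lambda_{n+1}/\lambda_n=1$. Then linear maps $S:\mathcal A\to L_2(M)_\nabla$ with $S(a)=\lambda_n^{-1/2}\partial(a)$ for all $a\in\mathcal A(\lambda_n)$ and all eigenvalues $\lambda_n\neq 0$ exist ($S$ being an arbitrary linear map on the finite dimensional space $\mathcal A(0)$, on which $\partial$ vanishes). Every such $S$ extends (via $a\mapsto a\Omega_\tau$) to a bounded operator $S:L_2(M)\to L_2(M)_\nabla$, and for all $x,y\in\mathcal A$ the operator $$T_{x,y}:L_2(M)\to L_2(M)_\nabla,\qquad T_{x,y}(\xi)=xS(\xi)y-S(x\xi y),$$ is compact. -/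

import Mathlib

open Filter Topology
open scoped ComplexOrder CStarAlgebra NNReal TensorProduct InnerProductSpace

noncomputable section

namespace QuantumMarkov

universe u

variable {M : Type u} [CStarAlgebra M] [PartialOrder M] [StarOrderedRing M]

/-! ### Finite von Neumann algebras -/

/-- A faithful normal (finite) trace on `M`.  Normality of a positive functional means that it
preserves suprema of bounded increasing nets, i.e. Scott continuity. -/
structure FaithfulNormalTrace (M : Type u) [CStarAlgebra M] [PartialOrder M]
    [StarOrderedRing M] where
  toFunctional : M →ₚ[ℂ] ℂ
  normal : ScottContinuous toFunctional
  faithful : ∀ x : M, toFunctional (star x * x) = 0 → x = 0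
  tracial : ∀ x y : M, toFunctional (x * y) = toFunctional (y * x)

/-- The σ-weak topology: the weakest topology making all normal positive functionals
continuous (these span the predual). -/
@[reducible]
def sigmaWeakTopology (M : Type u) [CStarAlgebra M] [PartialOrder M] [StarOrderedRing M] :
    TopologicalSpace M :=
  ⨅ φ : {φ : M →ₚ[ℂ] ℂ // ScottContinuous φ},
    TopologicalSpace.induced (fun x => φ.1 x) inferInstance

variable (τ : FaithfulNormalTrace M)

/-- `L₂(M, τ)`, the GNS Hilbert space of the trace. -/
abbrev L2 : Type u := τ.toFunctional.GNS

/-- The embedding `x ↦ x Ω_τ` of `M` into `L₂(M)`. -/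
def vec : M →ₗ[ℂ] L2 τ :=
  (UniformSpace.Completion.toComplL (𝕜 := ℂ) (E := τ.toFunctional.PreGNS)).toLinearMap ∘ₗ
    τ.toFunctional.toPreGNS.toLinearMap

/-- Left multiplication on `L₂(M)`. -/
def leftMul : M →⋆ₐ[ℂ] (L2 τ →L[ℂ] L2 τ) := τ.toFunctional.gnsStarAlgHom

lemma vec_apply (x : M) :
    vec τ x = ((τ.toFunctional.toPreGNS x : τ.toFunctional.PreGNS) : L2 τ) := rfl

@[simp] lemma leftMul_vec (a x : M) : leftMul τ a (vec τ x) = vec τ (a * x) := by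
  simp [leftMul, vec_apply]

lemma inner_vec (x y : M) : ⟪vec τ x, vec τ y⟫_ℂ = τ.toFunctional (star x * y) := by
  simp [vec_apply, PositiveLinearMap.preGNS_inner_def]

lemma denseRange_vec : DenseRange (vec τ) := by
  have h := (UniformSpace.Completion.denseRange_coe (α := τ.toFunctional.PreGNS))
  have := h.comp τ.toFunctional.toPreGNS.surjective.denseRange
    (UniformSpace.Completion.continuous_coe _)
  exact this

lemma vec_injective : Function.Injective (vec τ) := by
  rw [← LinearMap.ker_eq_bot, LinearMap.ker_eq_bot']
  intro x hx
  apply τ.faithful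
  rw [← inner_vec, hx, inner_zero_left]

lemma norm_vec_star (x : M) : ‖vec τ (star x)‖ = ‖vec τ x‖ := by
  have h : ∀ y : M, ‖vec τ y‖ ^ 2 = (τ.toFunctional (star y * y)).re := fun y => by
    rw [← inner_vec, ← inner_self_eq_norm_sq (𝕜 := ℂ)]; rfl
  rw [← sq_eq_sq₀ (norm_nonneg _) (norm_nonneg _), h, h, star_star, τ.tracial]

lemma norm_leftMul_le (a : M) : ‖leftMul τ a‖ ≤ ‖a‖ :=
  NonUnitalStarAlgHom.norm_apply_le (leftMul τ) a

lemma norm_vec_mul_le (x b : M) : ‖vec τ (x * b)‖ ≤ ‖b‖ * ‖vec τ x‖ := by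
  rw [← norm_vec_star, star_mul, ← leftMul_vec, ← norm_star b, ← norm_vec_star τ x]
  exact (leftMul τ (star b)).le_of_opNorm_le (norm_leftMul_le τ _) _

/-- A bounded linear map of `L₂(M)` extending a linear map of `M` that is bounded in `L₂`-norm. -/
def extend (f : M →ₗ[ℂ] M) (C : ℝ) (h : ∀ x, ‖vec τ (f x)‖ ≤ C * ‖vec τ x‖) :
    L2 τ →L[ℂ] L2 τ :=
  (LinearMap.mkContinuous (τ.toFunctional.toPreGNS.toLinearMap ∘ₗ f ∘ₗ
    τ.toFunctional.ofPreGNS.toLinearMap) C (fun x => by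
      have := h (τ.toFunctional.ofPreGNS x)
      simpa [vec_apply] using this)).completion

@[simp] lemma extend_vec (f : M →ₗ[ℂ] M) (C : ℝ) (h : ∀ x, ‖vec τ (f x)‖ ≤ C * ‖vec τ x‖)
    (x : M) : extend τ f C h (vec τ x) = vec τ (f x) := by
  simp [extend, vec_apply]

/-- Right multiplication on `L₂(M)`: `rightMul τ b (x Ω) = x b Ω`. -/
def rightMul (b : M) : L2 τ →L[ℂ] L2 τ :=
  extend τ (LinearMap.mulRight ℂ b) ‖b‖ (fun x => by simpa using norm_vec_mul_le τ x b)

@[simp] lemma rightMul_vec (b x : M) : rightMul τ b (vec τ x) = vec τ (x * b) := by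
  simp [rightMul]

lemma norm_le_of_vec {T : L2 τ →L[ℂ] L2 τ} {C : ℝ}
    (h : ∀ x, ‖T (vec τ x)‖ ≤ C * ‖vec τ x‖) (ξ : L2 τ) : ‖T ξ‖ ≤ C * ‖ξ‖ :=
  (denseRange_vec τ).induction_on ξ (isClosed_le (by fun_prop) (by fun_prop)) h

lemma rightMul_norm_le (b : M) (ξ : L2 τ) : ‖rightMul τ b ξ‖ ≤ ‖b‖ * ‖ξ‖ :=
  norm_le_of_vec τ (fun x => by simpa using norm_vec_mul_le τ x b) ξ

lemma rightMul_leftMul (a b : M) (ξ : L2 τ) :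
    rightMul τ b (leftMul τ a ξ) = leftMul τ a (rightMul τ b ξ) := by
  refine (denseRange_vec τ).induction_on ξ (isClosed_eq (by fun_prop) (by fun_prop)) ?_
  intro x
  simp [mul_assoc]

/-! ### Quantum Markov semi-groups -/

lemma exists_star_mul_self {B : Type*} [NonUnitalCStarAlgebra B] [PartialOrder B]
    [StarOrderedRing B] (a : B) (h : 0 ≤ a) : ∃ b, a = star b * b :=
  CStarAlgebra.nonneg_iff_eq_star_mul_self.mp h

lemma cp_factor (φ : M →CP M) {ι : Type*} [Fintype ι] (y : ι → M) :
    ∃ b : ι → ι → M, ∀ i j, φ (star (y i) * y j) = ∑ k, star (b k i) * b k j := by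
  classical
  rcases isEmpty_or_nonempty ι with hι | ⟨⟨k₀⟩⟩
  · exact ⟨fun _ _ => 0, fun i => (hι.false i).elim⟩
  · let B : CStarMatrix ι ι M := CStarMatrix.ofMatrix fun k i => if k = k₀ then y i else 0
    have h0 : 0 ≤ star B * B := star_mul_self_nonneg B
    have h1 := φ.map_cstarMatrix_nonneg _ h0
    obtain ⟨b, hb⟩ := exists_star_mul_self (B := CStarMatrix ι ι M) _ h1
    refine ⟨fun k i => b k i, fun i j => ?_⟩
    have h2 := congrArg (fun N : CStarMatrix ι ι M => N i j) hb
    have h3 : (star B * B) i j = star (y i) * y j := by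
      have : ∀ k i, B k i = if k = k₀ then y i else 0 := fun _ _ => rfl
      simp only [CStarMatrix.mul_apply, CStarMatrix.star_apply, this]
      simp
    rw [← h3]
    simpa only [CStarMatrix.mul_apply, CStarMatrix.star_apply, CStarMatrix.map_apply] using h2

lemma cp_star (φ : M →CP M) (x : M) : φ (star x) = star (φ x) := by
  obtain ⟨b, hb⟩ := cp_factor φ (ι := Bool) (fun i => bif i then x else 1)
  have h01 := hb false true
  have h10 := hb true false
  simp only [cond_true, cond_false, star_one, one_mul, mul_one] at h01 h10
  rw [h01, h10]; simp

lemma kadison_schwarz (φ : M →CP M) (h1 : φ 1 = 1) (x : M) :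
    star (φ x) * φ x ≤ φ (star x * x) := by
  obtain ⟨b, hb⟩ := cp_factor φ (ι := Bool) (fun i => bif i then x else 1)
  have h00 := hb false false
  have h01 := hb false true
  have h10 := hb true false
  have h11 := hb true true
  simp only [cond_true, cond_false, star_one, one_mul, mul_one, h1] at h00 h01 h10 h11
  have hs := (cp_star φ x).symm
  have key : 0 ≤ ∑ k, star (b k true - b k false * φ x) * (b k true - b k false * φ x) :=
    Finset.sum_nonneg fun k _ => star_mul_self_nonneg _
  have e : ∑ k, star (b k true - b k false * φ x) * (b k true - b k false * φ x)
      = φ (star x * x) - φ (star x) * φ x - star (φ x) * φ x + star (φ x) * 1 * φ x := by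
    rw [h11, h10, h00]
    conv_rhs => 
      enter [1, 2, 2]
      rw [h01]
    simp only [Fintype.sum_bool, star_sub, star_mul]
    conv_rhs =>
      enter [1, 2]
      rw [show (star (b true false) * b true true + star (b false false) * b false true) = φ x from
        by rw [h01]; simp]
    rw [show star (φ x) * φ x = star (φ x) * (∑ k, star (b k false) * b k true) by rw [← h01]]
    simp only [Fintype.sum_bool]
    noncomm_ring
  rw [e, hs, mul_one] at key
  rw [hs]
  simpa using key

/-- A quantum Markov semi-group on `(M, τ)`: a point-strongly continuous semi-group of
unital completely positive trace preserving symmetric maps. The strong topology is that of `M`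
acting on `L₂(M)`. -/
structure MarkovSemigroup where
  map : ℝ≥0 → M →CP M
  map_one : ∀ t, map t 1 = 1
  zero : ∀ x, map 0 x = x
  add : ∀ s t x, map (s + t) x = map s (map t x)
  trace_map : ∀ t x, τ.toFunctional (map t x) = τ.toFunctional x
  symmetric : ∀ t x y, τ.toFunctional (map t x * y) = τ.toFunctional (x * map t y)
  continuous : ∀ (x : M) (ξ : L2 τ), Continuous fun t => leftMul τ (map t x) ξ

variable {τ}
variable (Φ : MarkovSemigroup τ)

namespace MarkovSemigroup

lemma norm_vec_map_le (t : ℝ≥0) (x : M) : ‖vec τ (Φ.map t x)‖ ≤ 1 * ‖vec τ x‖ := by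
  have h : ∀ y : M, ‖vec τ y‖ ^ 2 = (τ.toFunctional (star y * y)).re := fun y => by
    rw [← inner_vec, ← inner_self_eq_norm_sq (𝕜 := ℂ)]; rfl
  rw [one_mul, ← sq_le_sq₀ (norm_nonneg _) (norm_nonneg _), h, h]
  have h1 := OrderHomClass.mono τ.toFunctional (kadison_schwarz (Φ.map t) (Φ.map_one t) x)
  rw [Φ.trace_map] at h1
  exact (Complex.le_def.mp h1).1

/-- The induced semi-group on `L₂(M)`: `P t (x Ω) = (Φ_t x) Ω`. -/
def P (t : ℝ≥0) : L2 τ →L[ℂ] L2 τ :=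
  extend τ (Φ.map t).toLinearMap 1 (Φ.norm_vec_map_le t)

@[simp] lemma P_vec (t : ℝ≥0) (x : M) : Φ.P t (vec τ x) = vec τ (Φ.map t x) := by
  simp [P]; rfl

/-- `HasGen Φ ξ η`: the vector `ξ` is in the domain of `Δ` and `Δ ξ = η`, where
`Δ ξ = lim_{t ↓ 0} t⁻¹ (ξ - P t ξ)`. -/
def HasGen (ξ η : L2 τ) : Prop :=
  Tendsto (fun t : ℝ≥0 => ((t : ℝ) : ℂ)⁻¹ • (ξ - Φ.P t ξ)) (𝓝[≠] 0) (𝓝 η)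


/-- The generator `Δ` of the semi-group `exp (-t Δ)` on `L₂(M)`, an unbounded operator. -/
def generator : L2 τ →ₗ.[ℂ] L2 τ where
  domain :=
    { carrier := {ξ | ∃ η, Φ.HasGen ξ η}
      zero_mem' := ⟨0, by simp [HasGen]⟩
      add_mem' := by
        rintro a b ⟨η, h⟩ ⟨η', h'⟩
        refine ⟨η + η', (h.add h').congr fun t => ?_⟩
        rw [map_add, ← smul_add]; congr 1; abel
      smul_mem' := by
        rintro c a ⟨η, h⟩
        refine ⟨c • η, (h.const_smul c).congr fun t => ?_⟩
        rw [map_smul, ← smul_sub, smul_comm] }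
  toFun :=
    { toFun := fun ξ => ξ.2.choose
      map_add' := by
        intro a b
        refine tendsto_nhds_unique (a + b).2.choose_spec
          ((a.2.choose_spec.add b.2.choose_spec).congr fun t => ?_)
        rw [Submodule.coe_add, map_add, ← smul_add]; congr 1; abel
      map_smul' := by
        intro c a
        refine tendsto_nhds_unique (c • a).2.choose_spec
          ((a.2.choose_spec.const_smul c).congr fun t => ?_)
        rw [Submodule.coe_smul, map_smul, ← smul_sub, smul_comm] }

lemma generator_hasGen (ξ : Φ.generator.domain) : Φ.HasGen ξ (Φ.generator ξ) :=
  ξ.2.choose_spec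

/-- The eigenspace of the generator `Δ` at `μ`. -/
def eigenspace (μ : ℝ) :
    Submodule ℂ (L2 τ) :=
  (LinearMap.ker (Φ.generator.toFun - (μ : ℂ) • Φ.generator.domain.subtype)).map
    Φ.generator.domain.subtype

/-- The generator `Δ` has compact resolvent: `(Δ - z)⁻¹` exists and is compact for some `z`. -/
def HasCompactResolvent : Prop :=
  ∃ (z : ℂ) (R : L2 τ →L[ℂ] L2 τ), IsCompactOperator R ∧
    (∀ ξ, ∃ h : R ξ ∈ Φ.generator.domain, Φ.generator ⟨R ξ, h⟩ - z • R ξ = ξ) ∧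
    ∀ ξ : Φ.generator.domain, R (Φ.generator ξ - z • (ξ : L2 τ)) = ξ

end MarkovSemigroup


/-! ### The core algebra, the carré du champ and the gradient tensor product -/

/-- A σ-weakly dense `*`-subalgebra `𝒜` of `M` whose image in `L₂(M)` lies in the domain of the
generator `Δ` and is mapped into itself by `Δ`, and on which the semi-group is
point-norm continuous. -/
structure CoreAlgebra where
  alg : NonUnitalStarSubalgebra ℂ M
  dense : @Dense M (sigmaWeakTopology M) (alg : Set M)
  mem_domain : ∀ a : alg, vec τ (a : M) ∈ Φ.generator.domain
  map_mem : ∀ a : alg, ∃ b : alg, Φ.generator ⟨vec τ (a : M), mem_domain a⟩ = vec τ (b : M)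
  norm_continuous : ∀ a : alg, Continuous fun t => Φ.map t (a : M)

namespace CoreAlgebra

variable {Φ}
variable (C : CoreAlgebra Φ)

/-- The embedding `a ↦ a Ω_τ` of `𝒜` into `L₂(M)`. -/
def toL2 : C.alg →ₗ[ℂ] L2 τ := vec τ ∘ₗ C.alg.toNonUnitalSubalgebra.toSubmodule.subtype

@[simp] lemma toL2_apply (a : C.alg) : C.toL2 a = vec τ (a : M) := rfl

/-- The generator on the level of the algebra: `lap a = b` where `Δ (a Ω) = b Ω`. -/
def lap : C.alg →ₗ[ℂ] C.alg where
  toFun a := (C.map_mem a).choose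
  map_add' a b := by
    apply Subtype.coe_injective
    apply vec_injective τ
    change vec τ _ = vec τ ((C.map_mem a).choose + (C.map_mem b).choose : M)
    rw [map_add, ← (C.map_mem (a + b)).choose_spec, ← (C.map_mem a).choose_spec,
      ← (C.map_mem b).choose_spec, ← LinearPMap.map_add]
    congr 1
    exact Subtype.ext (map_add (vec τ) _ _)
  map_smul' c a := by
    apply Subtype.coe_injective
    apply vec_injective τ
    change vec τ _ = vec τ (c • (C.map_mem a).choose : M)
    rw [map_smul, ← (C.map_mem (c • a)).choose_spec, ← (C.map_mem a).choose_spec,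
      ← LinearPMap.map_smul]
    congr 1
    exact Subtype.ext (map_smul (vec τ) _ _)

lemma generator_vec (a : C.alg) :
    Φ.generator ⟨vec τ (a : M), C.mem_domain a⟩ = vec τ (C.lap a : M) :=
  (C.map_mem a).choose_spec

/-- The gradient form `Γ(x, y) = ½ (Δ(y)* x + y* Δ(x) - Δ(y* x))`. -/
def Gam (x y : C.alg) : C.alg :=
  (1 / 2 : ℂ) • (star (C.lap y) * x + star y * C.lap x - C.lap (star y * x))

/-- The (degenerate) sesquilinear form on `𝒜 ⊗ L₂(M)`, conjugate linear in the first variable: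
`form (y ⊗ η) (x ⊗ ξ) = ⟪η, Γ(x, y) ξ⟫`. -/
def form : (C.alg ⊗[ℂ] L2 τ) →ₗ⋆[ℂ] (C.alg ⊗[ℂ] L2 τ) →ₗ[ℂ] ℂ :=
  TensorProduct.lift (LinearMap.mk₂'ₛₗ (starRingEnd ℂ) (starRingEnd ℂ)
    (fun (y : C.alg) (η : L2 τ) => TensorProduct.lift (LinearMap.mk₂ ℂ
      (fun (x : C.alg) (ξ : L2 τ) => ⟪η, leftMul τ (C.Gam x y : M) ξ⟫_ℂ)
      (fun x x' ξ => by
        rw [← inner_add_right, ← _root_.add_apply, ← map_add]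
        congr 3
        simp [Gam, mul_add]; simp only [← smul_add]; congr 1; abel)
      (fun c x ξ => by
        rw [← inner_smul_right_eq_smul, ← _root_.smul_apply,
          ← map_smul]
        congr 3
        simp only [Gam, map_smul, mul_smul_comm, ← smul_add, ← smul_sub]
        rw [smul_comm]; rfl)
      (fun x ξ ξ' => by simp [inner_add_right])
      (fun c x ξ => by simp [inner_smul_right])))
    (fun y y' η => by
      refine TensorProduct.ext' fun x ξ => ?_
      simp only [TensorProduct.lift.tmul, LinearMap.mk₂_apply, LinearMap.add_apply]
      rw [← inner_add_right, ← _root_.add_apply, ← map_add]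
      congr 3
      simp [Gam, add_mul]; simp only [← smul_add]; congr 1; abel)
    (fun c y η => by
      refine TensorProduct.ext' fun x ξ => ?_
      simp only [TensorProduct.lift.tmul, LinearMap.mk₂_apply, LinearMap.smul_apply]
      rw [← inner_smul_right_eq_smul, ← _root_.smul_apply,
          ← map_smul]
      congr 3
      simp only [Gam, map_smul, star_smul, smul_mul_assoc, ← smul_add, ← smul_sub]
      rw [smul_comm]; rfl)
    (fun y η η' => by
      refine TensorProduct.ext' fun x ξ => ?_
      simp [inner_add_left])
    (fun c y η => by
      refine TensorProduct.ext' fun x ξ => ?_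
      simp [inner_smul_left]))

@[simp] lemma form_tmul (x y : C.alg) (ξ η : L2 τ) :
    C.form (y ⊗ₜ η) (x ⊗ₜ ξ) = ⟪η, leftMul τ (C.Gam x y : M) ξ⟫_ℂ := rfl

lemma tendsto_lap (a : C.alg) :
    Tendsto (fun t : ℝ≥0 => vec τ (((t : ℝ) : ℂ)⁻¹ • ((a : M) - Φ.map t a))) (𝓝[≠] 0)
      (𝓝 (vec τ (C.lap a : M))) := by
  have h := Φ.generator_hasGen ⟨vec τ (a : M), C.mem_domain a⟩
  rw [generator_vec] at h
  refine Tendsto.congr (fun t => ?_) h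
  simp

lemma tendsto_star_lap (a : C.alg) :
    Tendsto (fun t : ℝ≥0 => vec τ (star (((t : ℝ) : ℂ)⁻¹ • ((a : M) - Φ.map t a)))) (𝓝[≠] 0)
      (𝓝 (vec τ (star (C.lap a : M)))) := by
  have h := C.tendsto_lap a
  rw [tendsto_iff_norm_sub_tendsto_zero] at h ⊢
  refine h.congr fun t => ?_
  rw [← map_sub, ← map_sub, ← star_sub, norm_vec_star]

/-- The approximation of `Γ(x, y)` obtained by replacing `Δ` by `(1 - Φ_t) / t`. -/
def gamT (t : ℝ≥0) (x y : M) : M :=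
  (1 / 2 : ℂ) • (((t : ℝ) : ℂ)⁻¹ •
    (star y * x - star (Φ.map t y) * x - star y * Φ.map t x + Φ.map t (star y * x)))

lemma tendsto_gamT (x y : C.alg) (m : M) (η : L2 τ) :
    Tendsto (fun t : ℝ≥0 => ⟪η, leftMul τ (gamT (Φ := Φ) t (x : M) y) (vec τ m)⟫_ℂ) (𝓝[≠] 0)
      (𝓝 ⟪η, leftMul τ (C.Gam x y : M) (vec τ m)⟫_ℂ) := by
  have h1 := ((rightMul τ (x : M)).continuous.tendsto _).comp (C.tendsto_star_lap y)
  have h2 := ((leftMul τ (star (y : M))).continuous.tendsto _).comp (C.tendsto_lap x)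
  have h3 := C.tendsto_lap (star y * x)
  have h4 := (((h1.add h2).sub h3).const_smul (1 / 2 : ℂ))
  have h5 := ((rightMul τ m).continuous.tendsto _).comp h4
  have h6 := (tendsto_const_nhds (x := η)).inner h5 (𝕜 := ℂ)
  have e : ∀ z : M, leftMul τ z (vec τ m) = rightMul τ m (vec τ z) := by simp
  simp only [e]
  have e1 : ∀ t : ℝ≥0, vec τ (gamT (Φ := Φ) t (x : M) y) = (1 / 2 : ℂ) •
      (rightMul τ (x : M) (vec τ (star (((t : ℝ) : ℂ)⁻¹ • ((y : M) - Φ.map t y)))) +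
        leftMul τ (star (y : M)) (vec τ (((t : ℝ) : ℂ)⁻¹ • ((x : M) - Φ.map t x))) -
        vec τ (((t : ℝ) : ℂ)⁻¹ •
          (((star y * x : C.alg) : M) - Φ.map t ((star y * x : C.alg) : M)))) := fun t => by
    simp only [rightMul_vec, leftMul_vec, ← map_add, ← map_sub, ← map_smul]
    congr 1
    simp only [gamT, star_smul, star_sub, smul_mul_assoc, mul_smul_comm]
    rw [show star (((t : ℝ) : ℂ)⁻¹) = ((t : ℝ) : ℂ)⁻¹ by simp, ← smul_add, ← smul_sub]
    have : ((star y * x : C.alg) : M) = star (y : M) * x := rfl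
    rw [this]
    congr 2
    noncomm_ring
  have e2 : vec τ (C.Gam x y : M) = (1 / 2 : ℂ) •
      (rightMul τ (x : M) (vec τ (star (C.lap y : M))) +
        leftMul τ (star (y : M)) (vec τ (C.lap x : M)) - vec τ (C.lap (star y * x) : M)) := by
    simp only [rightMul_vec, leftMul_vec, ← map_add, ← map_sub, ← map_smul]
    rfl
  rw [e2]
  simp only [e1]
  exact h6

lemma lap_star (a : C.alg) : C.lap (star a) = star (C.lap a) := by
  apply Subtype.coe_injective
  apply vec_injective τ
  refine tendsto_nhds_unique (C.tendsto_lap (star a))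
    ((C.tendsto_star_lap a).congr fun t => ?_)
  change _ = vec τ (((t : ℝ) : ℂ)⁻¹ • (star (a : M) - Φ.map t (star (a : M))))
  rw [cp_star, ← star_sub, star_smul]
  simp

lemma Gam_star (x y : C.alg) : star (C.Gam x y) = C.Gam y x := by
  simp only [Gam, star_smul, star_sub, star_add, star_mul, star_star, ← lap_star]
  rw [show star (1 / 2 : ℂ) = 1 / 2 by simp, add_comm]

lemma leftMul_star_inner (a : M) (ξ η : L2 τ) :
    ⟪leftMul τ (star a) ξ, η⟫_ℂ = ⟪ξ, leftMul τ a η⟫_ℂ := by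
  rw [map_star, ContinuousLinearMap.star_eq_adjoint, ContinuousLinearMap.adjoint_inner_left]

lemma leftMul_mul_inner (a b : M) (ξ η : L2 τ) :
    ⟪leftMul τ a ξ, leftMul τ b η⟫_ℂ = ⟪ξ, leftMul τ (star a * b) η⟫_ℂ := by
  have h := leftMul_star_inner (star a) ξ (leftMul τ b η)
  rw [star_star] at h
  rw [h, map_mul]
  rfl

lemma form_conj (u v : C.alg ⊗[ℂ] L2 τ) : starRingEnd ℂ (C.form v u) = C.form u v := by
  induction u with
  | zero => simp
  | add a b ha hb => simp [ha, hb]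
  | tmul x ξ =>
    induction v with
    | zero => simp
    | add a b ha hb => simp [ha, hb]
    | tmul y η =>
      rw [form_tmul, form_tmul, inner_conj_symm, ← leftMul_star_inner, ← Gam_star]
      simp

/-- `∑ ⟪ξ_i, Φ_t(y_i* y_j) ξ_j⟫`. -/
def cpForm (Φ : MarkovSemigroup τ) (t : ℝ≥0) {ι : Type} [Fintype ι] (y : ι → M)
    (ξ : ι → L2 τ) : ℂ :=
  ∑ i, ∑ j, ⟪ξ i, leftMul τ (Φ.map t (star (y i) * y j)) (ξ j)⟫_ℂ

lemma cpForm_eq (Φ : MarkovSemigroup τ) (t : ℝ≥0) {ι : Type} [Fintype ι] (y : ι → M) :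
    ∃ b : ι → ι → M, ∀ ξ : ι → L2 τ,
      cpForm Φ t y ξ = ((∑ k, ‖∑ j, leftMul τ (b k j) (ξ j)‖ ^ 2 : ℝ) : ℂ) := by
  obtain ⟨b, hb⟩ := cp_factor (Φ.map t) y
  refine ⟨b, fun ξ => ?_⟩
  simp only [cpForm, hb, map_sum, map_mul, Complex.ofReal_sum, Complex.ofReal_pow]
  have : ∀ k, ((‖∑ j, leftMul τ (b k j) (ξ j)‖ : ℝ) : ℂ) ^ 2 =
      ∑ i, ∑ j, ⟪leftMul τ (b k i) (ξ i), leftMul τ (b k j) (ξ j)⟫_ℂ := fun k => by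
    have := inner_self_eq_norm_sq_to_K (𝕜 := ℂ) (∑ j, leftMul τ (b k j) (ξ j))
    rw [sum_inner] at this
    simp only [inner_sum] at this
    exact this.symm
  simp only [this]
  refine Eq.symm ?_
  rw [Finset.sum_comm]
  refine Finset.sum_congr rfl fun i _ => ?_
  rw [Finset.sum_comm]
  refine Finset.sum_congr rfl fun j _ => ?_
  rw [_root_.sum_apply, inner_sum]
  refine Finset.sum_congr rfl fun k _ => ?_
  rw [leftMul_mul_inner, map_mul]

lemma cpForm_nonneg (Φ : MarkovSemigroup τ) (t : ℝ≥0) {ι : Type} [Fintype ι] (y : ι → M)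
    (ξ : ι → L2 τ) : 0 ≤ (cpForm Φ t y ξ).re := by
  obtain ⟨b, hb⟩ := cpForm_eq Φ t y
  rw [hb, Complex.ofReal_re]
  positivity

lemma cpForm_right (Φ : MarkovSemigroup τ) (t : ℝ≥0) {ι : Type} [Fintype ι] (y : ι → M)
    (ξ : ι → L2 τ) (x : M) :
    (cpForm Φ t y (fun i => rightMul τ x (ξ i))).re ≤ ‖x‖ ^ 2 * (cpForm Φ t y ξ).re := by
  obtain ⟨b, hb⟩ := cpForm_eq Φ t y
  rw [hb, hb, Complex.ofReal_re, Complex.ofReal_re, Finset.mul_sum]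
  refine Finset.sum_le_sum fun k _ => ?_
  simp only [← rightMul_leftMul, ← map_sum]
  rw [← mul_pow]
  gcongr
  exact rightMul_norm_le τ _ _

lemma cpForm_left (Φ : MarkovSemigroup τ) (t : ℝ≥0) {ι : Type} [Fintype ι] (y : ι → M)
    (ξ : ι → L2 τ) (x : M) :
    (cpForm Φ t (fun i => x * y i) ξ).re ≤ ‖x‖ ^ 2 * (cpForm Φ t y ξ).re := by
  obtain ⟨c, hc⟩ := exists_star_mul_self (algebraMap ℝ M (‖x‖ ^ 2) - star x * x)
    (sub_nonneg.mpr CStarAlgebra.star_mul_le_algebraMap_norm_sq)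
  have h : cpForm Φ t (fun i => x * y i) ξ + cpForm Φ t (fun i => c * y i) ξ =
      ((‖x‖ ^ 2 : ℝ) : ℂ) * cpForm Φ t y ξ := by
    simp only [cpForm, Finset.mul_sum, ← Finset.sum_add_distrib]
    refine Finset.sum_congr rfl fun i _ => Finset.sum_congr rfl fun j _ => ?_
    rw [← inner_add_right, ← _root_.add_apply, ← map_add, ← map_add, ← inner_smul_right,
      ← _root_.smul_apply, ← map_smul, ← map_smul]
    congr 4
    have : star (x * y i) * (x * y j) + star (c * y i) * (c * y j) =
        star (y i) * (star x * x + star c * c) * y j := by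
      simp only [star_mul]; noncomm_ring
    rw [this, ← hc]
    simp [Algebra.algebraMap_eq_smul_one, ← Complex.coe_smul]
  have h' := congrArg Complex.re h
  rw [Complex.add_re, Complex.re_ofReal_mul] at h'
  have := cpForm_nonneg Φ t (fun i => c * y i) ξ
  linarith

/-- The approximating form `∑ ⟪ξ_i, Γ_t(y_j, y_i) ξ_j⟫`. -/
def formT (Φ : MarkovSemigroup τ) (t : ℝ≥0) {ι : Type} [Fintype ι] (y : ι → M)
    (ξ : ι → L2 τ) : ℂ :=
  ∑ i, ∑ j, ⟪ξ i, leftMul τ (gamT (Φ := Φ) t (y j) (y i)) (ξ j)⟫_ℂ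

lemma formT_eq_cpForm (t : ℝ≥0) {ι : Type} [Fintype ι] (y : ι → M)
    (ξ : ι → L2 τ) (h0 : ∑ i, leftMul τ (y i) (ξ i) = 0) :
    formT Φ t y ξ = ((1 / 2 * (t : ℝ)⁻¹ : ℝ) : ℂ) * cpForm Φ t y ξ := by
  have e : ∀ i j, ⟪ξ i, leftMul τ (gamT (Φ := Φ) t (y j) (y i)) (ξ j)⟫_ℂ =
      ((1 / 2 * (t : ℝ)⁻¹ : ℝ) : ℂ) * (⟪leftMul τ (y i) (ξ i), leftMul τ (y j) (ξ j)⟫_ℂ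
        - ⟪leftMul τ (Φ.map t (y i)) (ξ i), leftMul τ (y j) (ξ j)⟫_ℂ
        - ⟪leftMul τ (y i) (ξ i), leftMul τ (Φ.map t (y j)) (ξ j)⟫_ℂ
        + ⟪ξ i, leftMul τ (Φ.map t (star (y i) * y j)) (ξ j)⟫_ℂ) := by
    intro i j
    simp only [leftMul_mul_inner, gamT, map_smul, map_add, map_sub, _root_.smul_apply, _root_.add_apply,
      _root_.sub_apply, inner_smul_right, inner_add_right, inner_sub_right]
    push_cast
    ring
  simp only [formT, cpForm, e, ← Finset.mul_sum, Finset.sum_add_distrib, Finset.sum_sub_distrib]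
  congr 1
  simp only [← inner_sum, ← sum_inner, h0, inner_zero_left, inner_zero_right]
  simp

/-- Adding the index `none` with the unit. -/
def ext1 {ι : Type} (y : ι → M) : Option ι → M := fun o => o.elim 1 y

/-- Adding the vector `-∑ y_i ξ_i` at the index `none`. -/
def ext0 {ι : Type} [Fintype ι] (y : ι → M) (ξ : ι → L2 τ) : Option ι → L2 τ :=
  fun o => o.elim (-∑ i, leftMul τ (y i) (ξ i)) ξ

lemma ext_sum {ι : Type} [Fintype ι] (y : ι → M) (ξ : ι → L2 τ) :
    ∑ o, leftMul τ (ext1 y o) (ext0 y ξ o) = 0 := by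
  simp [ext1, ext0, Fintype.sum_option]

lemma gamT_one_left (t : ℝ≥0) (x : M) : gamT (Φ := Φ) t 1 x = 0 := by
  simp [gamT, Φ.map_one, cp_star]

lemma gamT_one_right (t : ℝ≥0) (x : M) : gamT (Φ := Φ) t x 1 = 0 := by
  simp [gamT, Φ.map_one]

lemma formT_ext (t : ℝ≥0) {ι : Type} [Fintype ι] (y : ι → M) (ξ : ι → L2 τ) :
    formT Φ t (ext1 y) (ext0 y ξ) = formT Φ t y ξ := by
  simp [formT, ext1, ext0, Fintype.sum_option, gamT_one_left, gamT_one_right]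

lemma formT_eq (t : ℝ≥0) {ι : Type} [Fintype ι] (y : ι → M) (ξ : ι → L2 τ) :
    formT Φ t y ξ = ((1 / 2 * (t : ℝ)⁻¹ : ℝ) : ℂ) * cpForm Φ t (ext1 y) (ext0 y ξ) := by
  rw [← formT_ext, formT_eq_cpForm _ _ _ (ext_sum y ξ)]

lemma formT_nonneg (t : ℝ≥0) {ι : Type} [Fintype ι] (y : ι → M) (ξ : ι → L2 τ) :
    0 ≤ (formT Φ t y ξ).re := by
  rw [formT_eq, Complex.re_ofReal_mul]
  have := cpForm_nonneg Φ t (ext1 y) (ext0 y ξ)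
  positivity

lemma formT_right (t : ℝ≥0) {ι : Type} [Fintype ι] (y : ι → M) (ξ : ι → L2 τ) (x : M) :
    (formT Φ t y (fun i => rightMul τ x (ξ i))).re ≤ ‖x‖ ^ 2 * (formT Φ t y ξ).re := by
  have e : ext0 y (fun i => rightMul τ x (ξ i)) = fun o => rightMul τ x (ext0 y ξ o) := by
    funext o
    cases o <;> simp [ext0, rightMul_leftMul]
  rw [formT_eq, formT_eq, Complex.re_ofReal_mul, Complex.re_ofReal_mul, e]
  have := cpForm_right Φ t (ext1 y) (ext0 y ξ) x
  have h : (0 : ℝ) ≤ 1 / 2 * (t : ℝ)⁻¹ := by positivity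
  nlinarith [mul_le_mul_of_nonneg_left this h]

lemma formT_left (t : ℝ≥0) {ι : Type} [Fintype ι] (y : ι → M) (ξ : ι → L2 τ) (x : M) :
    (formT Φ t (fun o => x * ext1 y o) (ext0 y ξ)).re ≤ ‖x‖ ^ 2 * (formT Φ t y ξ).re := by
  have h0 : ∑ o, leftMul τ (x * ext1 y o) (ext0 y ξ o) = 0 := by
    have h := congrArg (leftMul τ x) (ext_sum y ξ)
    rw [map_sum, map_zero] at h
    rw [← h]
    refine Finset.sum_congr rfl fun o _ => ?_
    rw [map_mul]
    rfl
  rw [formT_eq_cpForm _ _ _ h0, formT_eq, Complex.re_ofReal_mul, Complex.re_ofReal_mul]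
  have := cpForm_left Φ t (ext1 y) (ext0 y ξ) x
  have h : (0 : ℝ) ≤ 1 / 2 * (t : ℝ)⁻¹ := by positivity
  nlinarith [mul_le_mul_of_nonneg_left this h]

/-- The algebraic tensor product `𝒜 ⊗ L₂(M)`, to be equipped with the gradient inner product. -/
def PreGrad : Type u := C.alg ⊗[ℂ] L2 τ

instance : AddCommGroup C.PreGrad := inferInstanceAs (AddCommGroup (C.alg ⊗[ℂ] L2 τ))
instance : Module ℂ C.PreGrad := inferInstanceAs (Module ℂ (C.alg ⊗[ℂ] L2 τ))

/-- The elementary tensor `y ⊗ ξ`. -/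
def tens (y : C.alg) (ξ : L2 τ) : C.PreGrad := (y ⊗ₜ[ℂ] ξ : C.alg ⊗[ℂ] L2 τ)

/-- The sum `∑ y_i ⊗ ξ_i`. -/
def tensSum {ι : Type} [Fintype ι] (y : ι → C.alg) (ξ : ι → L2 τ) : C.alg ⊗[ℂ] L2 τ :=
  ∑ i, y i ⊗ₜ[ℂ] ξ i

lemma exists_tensSum (u : C.alg ⊗[ℂ] L2 τ) :
    ∃ (n : ℕ) (y : Fin n → C.alg) (ξ : Fin n → L2 τ), u = C.tensSum y ξ := by
  obtain ⟨n, y, ξ, h⟩ := TensorProduct.exists_sum_tmul_eq u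
  exact ⟨n, y, ξ, h⟩

lemma form_tensSum {ι : Type} [Fintype ι] (y : ι → C.alg) (ξ : ι → L2 τ) :
    C.form (C.tensSum y ξ) (C.tensSum y ξ) =
      ∑ i, ∑ j, ⟪ξ i, leftMul τ (C.Gam (y j) (y i) : M) (ξ j)⟫_ℂ := by
  simp only [tensSum, map_sum, LinearMap.sum_apply, form_tmul]
  exact Finset.sum_comm

lemma tendsto_formT {ι : Type} [Fintype ι] (y : ι → C.alg) (m : ι → M) :
    Tendsto (fun t : ℝ≥0 => (formT Φ t (fun i => (y i : M)) (fun i => vec τ (m i))).re) (𝓝[≠] 0)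
      (𝓝 (C.form (C.tensSum y fun i => vec τ (m i)) (C.tensSum y fun i => vec τ (m i))).re) := by
  rw [form_tensSum]
  refine (Complex.continuous_re.tendsto _).comp ?_
  exact tendsto_finsetSum _ fun i _ => tendsto_finsetSum _ fun j _ =>
    C.tendsto_gamT (y j) (y i) (m j) (vec τ (m i))

lemma continuous_form {ι : Type} [Fintype ι] (y : ι → C.alg) {X : Type*} [TopologicalSpace X]
    (f : X → ι → L2 τ) (hf : ∀ i, Continuous fun x => f x i) :
    Continuous fun x => (C.form (C.tensSum y (f x)) (C.tensSum y (f x))).re := by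
  simp only [form_tensSum]
  fun_prop

lemma denseRange_pi {ι : Type} :
    DenseRange (fun (m : ι → M) (i : ι) => vec τ (m i)) :=
  DenseRange.piMap fun _ => denseRange_vec τ

lemma form_nonneg (u : C.alg ⊗[ℂ] L2 τ) : 0 ≤ (C.form u u).re := by
  obtain ⟨n, y, ξ, rfl⟩ := C.exists_tensSum u
  refine (denseRange_pi (τ := τ) (ι := Fin n)).induction_on ξ
    (isClosed_le continuous_const (C.continuous_form y _ (by fun_prop))) fun m => ?_
  exact ge_of_tendsto' (C.tendsto_formT y m) fun t => formT_nonneg t _ _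

/-- The right action of `x` on `𝒜 ⊗ L₂(M)`: `(y ⊗ ξ) · x = y ⊗ ξ x`. -/
def preRight (x : C.alg) : C.alg ⊗[ℂ] L2 τ →ₗ[ℂ] C.alg ⊗[ℂ] L2 τ :=
  LinearMap.lTensor C.alg (rightMul τ (x : M)).toLinearMap

@[simp] lemma preRight_tmul (x y : C.alg) (ξ : L2 τ) :
    C.preRight x (y ⊗ₜ ξ) = y ⊗ₜ rightMul τ (x : M) ξ := rfl

/-- The left action of `x` on `𝒜 ⊗ L₂(M)`: `x · (y ⊗ ξ) = x y ⊗ ξ - x ⊗ y ξ`. -/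
def preLeft (x : C.alg) : C.alg ⊗[ℂ] L2 τ →ₗ[ℂ] C.alg ⊗[ℂ] L2 τ :=
  TensorProduct.lift (LinearMap.mk₂ ℂ
    (fun (y : C.alg) (ξ : L2 τ) => (x * y) ⊗ₜ[ℂ] ξ - x ⊗ₜ[ℂ] leftMul τ (y : M) ξ)
    (fun y y' ξ => by
      have : ((y + y' : C.alg) : M) = (y : M) + (y' : M) := rfl
      rw [this, mul_add, TensorProduct.add_tmul, map_add, _root_.add_apply,
        TensorProduct.tmul_add]
      abel)
    (fun c y ξ => by
      have : ((c • y : C.alg) : M) = c • (y : M) := rfl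
      rw [this, mul_smul_comm, map_smul, _root_.smul_apply, TensorProduct.tmul_smul, smul_sub,
        TensorProduct.smul_tmul', TensorProduct.smul_tmul'])
    (fun y ξ ξ' => by
      simp only [map_add, TensorProduct.tmul_add]
      abel)
    (fun c y ξ => by
      simp only [map_smul, TensorProduct.tmul_smul, smul_sub]))

@[simp] lemma preLeft_tmul (x y : C.alg) (ξ : L2 τ) :
    C.preLeft x (y ⊗ₜ ξ) = (x * y) ⊗ₜ[ℂ] ξ - x ⊗ₜ[ℂ] leftMul τ (y : M) ξ := rfl

lemma preRight_tensSum (x : C.alg) {ι : Type} [Fintype ι] (y : ι → C.alg) (ξ : ι → L2 τ) :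
    C.preRight x (C.tensSum y ξ) = C.tensSum y (fun i => rightMul τ (x : M) (ξ i)) := by
  simp [tensSum]

lemma preLeft_tensSum (x : C.alg) {ι : Type} [Fintype ι] (y : ι → C.alg) (ξ : ι → L2 τ) :
    C.preLeft x (C.tensSum y ξ) =
      C.tensSum (fun o : Option ι => o.elim x (fun i => x * y i)) (ext0 (fun i => (y i : M)) ξ) := by
  simp only [tensSum, map_sum, preLeft_tmul, Finset.sum_sub_distrib, Fintype.sum_option, ext0,
    Option.elim_none, Option.elim_some, TensorProduct.tmul_neg, TensorProduct.tmul_sum]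
  abel

lemma form_preRight_le (x : C.alg) (u : C.alg ⊗[ℂ] L2 τ) :
    (C.form (C.preRight x u) (C.preRight x u)).re ≤ ‖(x : M)‖ ^ 2 * (C.form u u).re := by
  obtain ⟨n, y, ξ, rfl⟩ := C.exists_tensSum u
  rw [preRight_tensSum]
  refine (denseRange_pi (τ := τ) (ι := Fin n)).induction_on ξ
    (isClosed_le (C.continuous_form y _ (by fun_prop))
      (continuous_const.mul (C.continuous_form y _ (by fun_prop)))) fun m => ?_
  have h1 := C.tendsto_formT y m
  have h2 := C.tendsto_formT y (fun i => m i * x)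
  simp only [← rightMul_vec] at h2
  exact le_of_tendsto_of_tendsto' h2 (h1.const_mul _) fun t => formT_right t _ _ _

lemma form_preLeft_le (x : C.alg) (u : C.alg ⊗[ℂ] L2 τ) :
    (C.form (C.preLeft x u) (C.preLeft x u)).re ≤ ‖(x : M)‖ ^ 2 * (C.form u u).re := by
  obtain ⟨n, y, ξ, rfl⟩ := C.exists_tensSum u
  rw [preLeft_tensSum]
  refine (denseRange_pi (τ := τ) (ι := Fin n)).induction_on ξ
    (isClosed_le (C.continuous_form _ _ fun o => ?_)
      (continuous_const.mul (C.continuous_form y _ (by fun_prop)))) fun m => ?_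
  · cases o <;> simp only [ext0, Option.elim_none, Option.elim_some] <;> fun_prop
  have h1 := C.tendsto_formT y m
  have h2 := C.tendsto_formT (fun o : Option (Fin n) => o.elim x (fun i => x * y i))
    (fun o => o.elim (-∑ i, (y i : M) * m i) m)
  have e1 : (fun o : Option (Fin n) => vec τ (o.elim (-∑ i, (y i : M) * m i) m)) =
      ext0 (fun i => (y i : M)) (fun i => vec τ (m i)) := by
    funext o
    cases o <;> simp [ext0]
  have e2 : (fun o : Option (Fin n) => ((o.elim x (fun i => x * y i) : C.alg) : M)) =
      fun o => (x : M) * ext1 (fun i => (y i : M)) o := by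
    funext o
    cases o
    · simp [ext1]
    · rfl
  rw [e1, e2] at h2
  exact le_of_tendsto_of_tendsto' h2 (h1.const_mul _) fun t => formT_left t _ _ _

/-- The gradient inner product `⟪y ⊗ η, x ⊗ ξ⟫ = ⟪η, Γ(x, y) ξ⟫` on `𝒜 ⊗ L₂(M)`. -/
abbrev preGradCore : PreInnerProductSpace.Core ℂ C.PreGrad where
  inner u v := C.form u v
  conj_inner_symm u v := C.form_conj u v
  re_inner_nonneg u := C.form_nonneg u
  add_left u v w := LinearMap.map_add₂ C.form u v w
  smul_left u v c := LinearMap.map_smulₛₗ₂ C.form c u v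

instance : SeminormedAddCommGroup C.PreGrad :=
  InnerProductSpace.Core.toSeminormedAddCommGroup (c := C.preGradCore)
instance : InnerProductSpace ℂ C.PreGrad := InnerProductSpace.ofCore C.preGradCore

lemma preGrad_inner (u v : C.PreGrad) : ⟪u, v⟫_ℂ = C.form u v := rfl

lemma preGrad_norm_sq (u : C.PreGrad) : ‖u‖ ^ 2 = (C.form u u).re := by
  rw [← preGrad_inner, ← inner_self_eq_norm_sq (𝕜 := ℂ)]; rfl

/-- The gradient tensor product `L₂(M)_∇`: the Hilbert space obtained from `𝒜 ⊗ L₂(M)` with the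
gradient inner product by dividing out the vectors of norm zero and completing. -/
abbrev GradSpace : Type u := UniformSpace.Completion C.PreGrad

/-- The class `y ⊗_∇ ξ` in `L₂(M)_∇`. -/
def gtens (y : C.alg) (ξ : L2 τ) : C.GradSpace := ((C.tens y ξ : C.PreGrad) : C.GradSpace)

/-- The left action of `𝒜` on `L₂(M)_∇`. -/
def leftAct (x : C.alg) : C.GradSpace →L[ℂ] C.GradSpace :=
  (LinearMap.mkContinuous (C.preLeft x : C.PreGrad →ₗ[ℂ] C.PreGrad) ‖(x : M)‖ fun u => by
    rw [← sq_le_sq₀ (norm_nonneg _) (by positivity), mul_pow, preGrad_norm_sq, preGrad_norm_sq]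
    exact C.form_preLeft_le x u).completion

/-- The right action of `𝒜` on `L₂(M)_∇`. -/
def rightAct (x : C.alg) : C.GradSpace →L[ℂ] C.GradSpace :=
  (LinearMap.mkContinuous (C.preRight x : C.PreGrad →ₗ[ℂ] C.PreGrad) ‖(x : M)‖ fun u => by
    rw [← sq_le_sq₀ (norm_nonneg _) (by positivity), mul_pow, preGrad_norm_sq, preGrad_norm_sq]
    exact C.form_preRight_le x u).completion

/-- The derivation `∂ : 𝒜 → L₂(M)_∇`, `∂ a = a ⊗_∇ Ω_τ`. -/
def deriv : C.alg →ₗ[ℂ] C.GradSpace where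
  toFun a := C.gtens a (vec τ 1)
  map_add' a b := by
    rw [gtens, gtens, gtens, ← UniformSpace.Completion.coe_add]
    exact congrArg _ (TensorProduct.add_tmul a b (vec τ 1))
  map_smul' c a := by
    rw [gtens, gtens, RingHom.id_apply, ← UniformSpace.Completion.coe_smul]
    exact congrArg _ (TensorProduct.smul_tmul' c a (vec τ 1)).symm

lemma inner_gtens (x y : C.alg) (ξ η : L2 τ) :
    ⟪C.gtens y η, C.gtens x ξ⟫_ℂ = ⟪η, leftMul τ (C.Gam x y : M) ξ⟫_ℂ := by
  rw [gtens, gtens, UniformSpace.Completion.inner_coe]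
  rfl

lemma leftAct_gtens (x y : C.alg) (ξ : L2 τ) :
    C.leftAct x (C.gtens y ξ) = C.gtens (x * y) ξ - C.gtens x (leftMul τ (y : M) ξ) := by
  rw [gtens, gtens, gtens, leftAct, ContinuousLinearMap.completion_apply_coe,
    ← UniformSpace.Completion.coe_sub]
  rfl

lemma rightAct_gtens (x y : C.alg) (ξ : L2 τ) :
    C.rightAct x (C.gtens y ξ) = C.gtens y (rightMul τ (x : M) ξ) := by
  rw [gtens, gtens, rightAct, ContinuousLinearMap.completion_apply_coe]
  rfl

/-! ### Filtered generators of subexponential growth -/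

/-- The subspace `𝒜(μ) = {a ∈ 𝒜 | a Ω_τ is in the eigenspace of Δ at μ}`. -/
def specSub (μ : ℝ) : Submodule ℂ C.alg := (Φ.eigenspace μ).comap C.toL2

/-- `Δ` is filtered, `lam` being the increasing enumeration of its eigenvalues. As `a ↦ a Ω_τ` is
injective, `𝒜(λ)` is the only subspace of `𝒜` whose image can be the eigenspace at `λ`. -/
structure IsFiltered (lam : ℕ → ℝ) : Prop where
  compact_resolvent : Φ.HasCompactResolvent
  strictMono : StrictMono lam
  range_eq : Set.range lam = {μ : ℝ | Φ.eigenspace μ ≠ ⊥}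
  map_specSub : ∀ n, (C.specSub (lam n)).map C.toL2 = Φ.eigenspace (lam n)
  directSum : DirectSum.IsInternal fun n => C.specSub (lam n)
  mul_mem : ∀ n m, ∀ a ∈ C.specSub (lam n), ∀ b ∈ C.specSub (lam m),
    a * b ∈ ⨆ k ∈ Finset.range (m + n + 1), C.specSub (lam k)

/-- Subexponential growth of the sequence of eigenvalues. -/
def SubexponentialGrowth (lam : ℕ → ℝ) : Prop :=
  Tendsto (fun n => lam (n + 1) / lam n) atTop (𝓝 1)

/-- `S : 𝒜 → L₂(M)_∇` is a normalization of `∂`: `S a = λ_n^{-1/2} ∂ a` for `a ∈ 𝒜(λ_n)` and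
every eigenvalue `λ_n ≠ 0`. On the finite dimensional space `𝒜(0)`, where `∂` vanishes, the
linear map `S` is arbitrary. -/
def IsNormalizedDerivation (lam : ℕ → ℝ) (S : C.alg →ₗ[ℂ] C.GradSpace) : Prop :=
  ∀ n, lam n ≠ 0 → ∀ a ∈ C.specSub (lam n), S a = (((lam n) ^ (-(1 / 2) : ℝ) : ℝ) : ℂ) • C.deriv a

/-- The operator `T_{x,y} ξ = x S(ξ) y - S(x ξ y)`. -/
def commOp (S : L2 τ →L[ℂ] C.GradSpace) (x y : C.alg) : L2 τ →L[ℂ] C.GradSpace :=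
  C.rightAct y ∘L C.leftAct x ∘L S - S ∘L leftMul τ (x : M) ∘L rightMul τ (y : M)

end CoreAlgebra

end QuantumMarkov

end

/-! Write a finite sum `a = ∑ b n` with `b n ∈ 𝒜(λ_n)`, `n ≥ 1`, and put `B = ∑ λ_n^{-1/2} b n`, so
that `S a = ∂ B`. The formula for `x · ∂(B) · y` in `rightAct_leftAct_deriv` gives `T_{x,y} a = (∂(x
B y) - S(x a y)) - (x B) · ∂ y - x ⊗_∇ B y`.

The last two terms are bounded by a constant times `‖B Ω‖`: for the first because `‖c · ∂ y‖² = τ(c*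
c Γ(y*, y*))` (`norm_leftAct_deriv_le`), for the second because `Γ(x, x)` is a bounded operator
(`norm_gtens_le`). If all `n` are large, `‖B Ω‖` is a small multiple of `‖a Ω‖`, since compactness
of the resolvent forces `λ_n → ∞` (`tendsto_atTop`).

For the first term, let `L` be the sum of the filtration degrees of `x` and `y`. The components of
`x (b n) y` lie in `𝒜(λ_k)` with `|k - n| ≤ L`: the upper bound is the filtration property, the
lower bound follows from it by taking adjoints (`exists_band`). On the `k`-th component the
difference is `(λ_n^{-1/2} λ_k^{1/2} - 1) S`, and subexponential growth makes this scalar small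
uniformly over the band (`eventually_band`). A band matrix of fixed width with small entries has
small norm (`norm_band_sum_le`).

So `T_{x,y}` is small on tails of the eigenspace decomposition (`commOp_tail`). The eigenspaces are
finite dimensional, so `T_{x,y}` is a norm limit of finite rank operators
(`isCompactOperator_of_tail`). This needs the eigenspaces to be total in `L₂(M)`, hence `𝒜 Ω` dense;
σ-weak density of `𝒜` yields it because vector functionals are normal
(`scottContinuous_vecFunctional`). -/

noncomputable section

namespace QuantumMarkov

universe u

/-! ### Orthogonal families in Hilbert space: band sums and a compactness criterion. -/

section HilbertSpace

variable {H G : Type*} [NormedAddCommGroup H] [InnerProductSpace ℂ H]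
  [NormedAddCommGroup G] [InnerProductSpace ℂ G]

/-- Pythagoras for finitely many vectors of an orthogonal family of subspaces. -/
lemma norm_sq_sum_of_orthogonalFamily {E : ℕ → Submodule ℂ H}
    (hE : OrthogonalFamily ℂ (fun n => E n) fun n => (E n).subtypeₗᵢ) (s : Finset ℕ) {a : ℕ → H}
    (ha : ∀ n ∈ s, a n ∈ E n) : ‖∑ n ∈ s, a n‖ ^ 2 = ∑ n ∈ s, ‖a n‖ ^ 2 := by
  classical
  have h := hE.norm_sum (fun n => if h : n ∈ s then ⟨a n, ha n h⟩ else 0) s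
  rw [Finset.sum_congr rfl (g := a) fun n hn => by simp [hn]] at h
  rw [h]
  exact Finset.sum_congr rfl fun n hn => by simp [hn]

/-- Multiplying the components of a vector by scalars bounded by `r`. -/
lemma norm_sum_smul_le {E : ℕ → Submodule ℂ H}
    (hE : OrthogonalFamily ℂ (fun n => E n) fun n => (E n).subtypeₗᵢ) (s : Finset ℕ) {a : ℕ → H}
    (ha : ∀ n ∈ s, a n ∈ E n) {c : ℕ → ℂ} {r : ℝ} (hr : 0 ≤ r) (hc : ∀ n ∈ s, ‖c n‖ ≤ r) :
    ‖∑ n ∈ s, c n • a n‖ ≤ r * ‖∑ n ∈ s, a n‖ := by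
  rw [← sq_le_sq₀ (norm_nonneg _) (by positivity), mul_pow,
    norm_sq_sum_of_orthogonalFamily hE s ha,
    norm_sq_sum_of_orthogonalFamily hE s fun n hn => (E n).smul_mem _ (ha n hn), Finset.mul_sum]
  refine Finset.sum_le_sum fun n hn => ?_
  rw [norm_smul, mul_pow]
  gcongr
  exact hc n hn

/-- An operator of band width `L`, with small entries, has small norm. -/
lemma norm_band_sum_le {E : ℕ → Submodule ℂ H}
    (hE : OrthogonalFamily ℂ (fun n => E n) fun n => (E n).subtypeₗᵢ) (L : ℕ) (s : Finset ℕ)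
    (hs : ∀ n ∈ s, L ≤ n) {a : ℕ → H} (ha : ∀ n ∈ s, a n ∈ E n) (w : ℕ → ℕ → H)
    (hw : ∀ n ∈ s, ∀ j, w n j ∈ E (n + j - L)) {r : ℝ} (hr : 0 ≤ r)
    (hle : ∀ n ∈ s, ∀ j ∈ Finset.range (2 * L + 1), ‖w n j‖ ≤ r * ‖a n‖) :
    ‖∑ n ∈ s, ∑ j ∈ Finset.range (2 * L + 1), w n j‖ ≤
      (2 * L + 1 : ℕ) * (r * ‖∑ n ∈ s, a n‖) := by
  rw [Finset.sum_comm]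
  refine (norm_sum_le _ _).trans ?_
  rw [← nsmul_eq_mul, ← Finset.card_range (2 * L + 1), ← Finset.sum_const, Finset.card_range]
  refine Finset.sum_le_sum fun j hj => ?_
  -- Fix a diagonal `j`. As `n ≥ L`, the subtraction is not truncated, so the shift is injective and
  -- the vectors on one diagonal lie in different members of the family; Pythagoras then applies to
  -- each of the `2L + 1` diagonals.
  have hinj : Set.InjOn (fun n => n + j - L) s := fun n hn m hm h => by
    have h1 := hs n hn
    have h2 := hs m hm
    simp only at h
    omega
  have e : ∑ n ∈ s, w n j =
      ∑ k ∈ s.image (fun n => n + j - L), w (k + L - j) j := by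
    rw [Finset.sum_image hinj]
    refine Finset.sum_congr rfl fun n hn => ?_
    have := hs n hn
    congr 1
    omega
  rw [← sq_le_sq₀ (norm_nonneg _) (by positivity), e, mul_pow,
    norm_sq_sum_of_orthogonalFamily hE, Finset.sum_image hinj,
    norm_sq_sum_of_orthogonalFamily hE s ha, Finset.mul_sum]
  · refine Finset.sum_le_sum fun n hn => ?_
    have := hs n hn
    rw [← mul_pow, show n + j - L + L - j = n by omega]
    gcongr
    exact hle n hn j hj
  · intro k hk
    obtain ⟨n, hn, rfl⟩ := Finset.mem_image.mp hk
    have := hs n hn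
    rw [show n + j - L + L - j = n by omega]
    exact hw n hn j

/-- An operator which is small on the tails of a total orthogonal family of finite dimensional
subspaces is compact. -/
lemma isCompactOperator_of_tail [CompleteSpace H] [CompleteSpace G] {E : ℕ → Submodule ℂ H}
    (hE : OrthogonalFamily ℂ (fun n => E n) fun n => (E n).subtypeₗᵢ)
    (hfd : ∀ n, FiniteDimensional ℂ (E n)) (hdense : Dense ((⨆ n, E n : Submodule ℂ H) : Set H))
    (T : H →L[ℂ] G)
    (hT : ∀ ε > 0, ∃ N : ℕ, ∀ s : Finset ℕ, (∀ n ∈ s, N ≤ n) → ∀ a : ℕ → H,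
      (∀ n, a n ∈ E n) → ‖T (∑ n ∈ s, a n)‖ ≤ ε * ‖∑ n ∈ s, a n‖) :
    IsCompactOperator T := by
  classical
  refine (isClosed_setOfPred_isCompactOperator (σ₁₂ := RingHom.id ℂ) (M₁ := H)
    (M₂ := G)).closure_subset
    (Metric.mem_closure_iff.mpr fun ε hε => ?_)
  obtain ⟨N, hN⟩ := hT (ε / 2) (half_pos hε)
  let F : Submodule ℂ H := ⨆ n ∈ Finset.range N, E n
  have : FiniteDimensional ℂ F := by
    rw [show F = (Finset.range N).sup E from (Finset.sup_eq_iSup _ _).symm]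
    exact Submodule.finiteDimensional_finset_sup _ _
  -- The approximant cuts `T` down to the first `N` subspaces. It has finite rank, and what remains
  -- is `T` on the tail `r` below.
  refine ⟨T ∘L F.starProjection, ?_, ?_⟩
  · have : ProperSpace F := FiniteDimensional.proper ℂ F
    have h : IsCompactOperator (T ∘L F.subtypeL) :=
      isCompactOperator_of_locallyCompactSpace_rng (T ∘L F.subtypeL)
    exact h.comp_clm F.orthogonalProjectionOnto
  · rw [dist_eq_norm]
    refine lt_of_le_of_lt (ContinuousLinearMap.opNorm_le_bound _ (half_pos hε).le fun ξ => ?_)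
      (half_lt_self hε)
    refine (hdense.denseRange_val).induction_on ξ (isClosed_le (by fun_prop) (by fun_prop)) ?_
    rintro ⟨ζ, hζ⟩
    obtain ⟨f, hf, rfl⟩ := (Submodule.mem_iSup_iff_exists_finsupp _ _).mp hζ
    simp only [Finsupp.sum]
    set s := f.support
    have hsplit := Finset.sum_filter_add_sum_filter_not s (fun n => n < N) f
    set q := ∑ n ∈ s with n < N, f n
    set r := ∑ n ∈ s with ¬ n < N, f n with hr
    have hq : F.starProjection q = q := Submodule.starProjection_eq_self_iff.mpr <|
      Submodule.sum_mem _ fun n hn => Submodule.mem_iSup_of_mem n <| Submodule.mem_iSup_of_mem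
        (Finset.mem_range.mpr (Finset.mem_filter.mp hn).2) (hf n)
    have hr0 : F.starProjection r = 0 := by
      rw [Submodule.starProjection_apply_eq_zero_iff]
      refine Submodule.sum_mem _ fun n hn => ?_
      have hFn : F ≤ (E n)ᗮ := iSup₂_le fun k hk => Submodule.isOrtho_iff_le.mp <|
        Submodule.isOrtho_iff_inner_eq.mpr fun u hu v hv => hE
          (show k ≠ n by have := (Finset.mem_filter.mp hn).2; have := Finset.mem_range.mp hk; omega)
          ⟨u, hu⟩ ⟨v, hv⟩
      exact (Submodule.le_orthogonal_iff_le_orthogonal.mp hFn) (hf n)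
    have hle : ‖r‖ ≤ ‖∑ n ∈ s, f n‖ := by
      rw [← sq_le_sq₀ (norm_nonneg _) (norm_nonneg _),
        norm_sq_sum_of_orthogonalFamily hE _ fun n _ => hf n,
        norm_sq_sum_of_orthogonalFamily hE _ fun n _ => hf n]
      exact Finset.sum_le_sum_of_subset_of_nonneg (Finset.filter_subset _ _)
        fun _ _ _ => sq_nonneg _
    have hTr : (T - T ∘L F.starProjection) (∑ n ∈ s, f n) = T r := by
      rw [← hsplit]
      simp [hq, hr0]
    rw [hTr]
    refine (hN _ (fun n hn => not_lt.mp (Finset.mem_filter.mp hn).2) f hf).trans ?_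
    gcongr

end HilbertSpace

/-! ### Normality of vector functionals, and the density of `𝒜 Ω` in `L₂(M)` -/

section Density

variable {M : Type u} [CStarAlgebra M] [PartialOrder M]

/-- A positive functional is normal iff it approximates the value at a supremum of a directed set
by the values at the members of the set. -/
lemma scottContinuous_iff_exists_lt (φ : M →ₚ[ℂ] ℂ) :
    ScottContinuous φ ↔ ∀ ⦃d : Set M⦄, d.Nonempty → DirectedOn (· ≤ ·) d → ∀ ⦃a : M⦄, IsLUB d a →
      ∀ ε > 0, ∃ x ∈ d, (φ (a - x)).re < ε := by
  have him : ∀ {x a : M}, x ≤ a → (φ x).im = (φ a).im := fun h =>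
    (Complex.le_def.mp (OrderHomClass.mono φ h)).2
  constructor
  · intro h d hd hdir a ha ε hε
    by_contra! hcon
    -- If no member comes within `ε`, then `φ a - ε` is an upper bound smaller than the supremum.
    -- Imaginary parts agree because comparable complex numbers have the same one.
    have hub : φ a - (ε : ℂ) ∈ upperBounds (φ '' d) := by
      rintro _ ⟨x, hx, rfl⟩
      have h1 := hcon x hx
      rw [map_sub, Complex.sub_re] at h1
      refine Complex.le_def.mpr ⟨?_, ?_⟩
      · simp only [Complex.sub_re, Complex.ofReal_re]
        linarith
      · simpa using him (ha.1 hx)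
    have h2 := (Complex.le_def.mp ((h hd hdir ha).2 hub)).1
    simp only [Complex.sub_re, Complex.ofReal_re] at h2
    linarith
  · intro h d hd hdir a ha
    refine ⟨?_, fun b hb => ?_⟩
    · rintro _ ⟨x, hx, rfl⟩
      exact OrderHomClass.mono φ (ha.1 hx)
    · have hle : ∀ x ∈ d, (φ x).re ≤ b.re ∧ (φ x).im = b.im := fun x hx =>
        Complex.le_def.mp (hb ⟨x, hx, rfl⟩)
      refine Complex.le_def.mpr ⟨le_of_forall_pos_lt_add fun ε hε => ?_, ?_⟩
      · obtain ⟨x, hx, hlt⟩ := h hd hdir ha ε hε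
        rw [map_sub, Complex.sub_re] at hlt
        linarith [(hle x hx).1]
      · obtain ⟨x, hx⟩ := hd
        rw [← him (ha.1 hx), (hle x hx).2]

variable [StarOrderedRing M] (τ : FaithfulNormalTrace M)

lemma inner_leftMul_star_mul_self (ξ : L2 τ) (b : M) :
    ⟪ξ, leftMul τ (star b * b) ξ⟫_ℂ = ((‖leftMul τ b ξ‖ ^ 2 : ℝ) : ℂ) := by
  rw [← CoreAlgebra.leftMul_mul_inner, inner_self_eq_norm_sq_to_K]
  norm_cast

/-- The vector functional `x ↦ ⟪ξ, x ξ⟫`. -/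
def vecFunctional (ξ : L2 τ) : M →ₚ[ℂ] ℂ :=
  PositiveLinearMap.mk₀
    { toFun := fun x => ⟪ξ, leftMul τ x ξ⟫_ℂ
      map_add' := fun x y => by
        rw [map_add, _root_.add_apply, inner_add_right]
      map_smul' := fun c x => by
        rw [map_smul, _root_.smul_apply, inner_smul_right]
        rfl }
    (fun x hx => by
      obtain ⟨b, rfl⟩ := exists_star_mul_self x hx
      change 0 ≤ ⟪ξ, leftMul τ (star b * b) ξ⟫_ℂ
      rw [inner_leftMul_star_mul_self]
      exact Complex.zero_le_real.mpr (sq_nonneg _))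

lemma vecFunctional_apply (ξ : L2 τ) (x : M) : vecFunctional τ ξ x = ⟪ξ, leftMul τ x ξ⟫_ℂ := rfl

/-- With `p = b* b` this is `‖u - v‖² ≤ 2‖u‖² + 2‖v‖²`. It replaces additivity in `ξ`, which vector
functionals do not have, in the proof of normality. -/
lemma vecFunctional_sub_le (ξ η : L2 τ) {p : M} (hp : 0 ≤ p) :
    (vecFunctional τ (ξ - η) p).re ≤
      2 * (vecFunctional τ ξ p).re + 2 * (vecFunctional τ η p).re := by
  obtain ⟨b, rfl⟩ := exists_star_mul_self p hp
  simp only [vecFunctional_apply, inner_leftMul_star_mul_self, Complex.ofReal_re]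
  rw [map_sub]
  have h := norm_sub_le (leftMul τ b ξ) (leftMul τ b η)
  nlinarith [sq_nonneg (‖leftMul τ b ξ‖ - ‖leftMul τ b η‖), norm_nonneg (leftMul τ b ξ -
    leftMul τ b η)]

lemma vecFunctional_le (ξ : L2 τ) (p : M) : (vecFunctional τ ξ p).re ≤ ‖p‖ * ‖ξ‖ ^ 2 := by
  rw [vecFunctional_apply]
  calc _ ≤ ‖⟪ξ, leftMul τ p ξ⟫_ℂ‖ := Complex.re_le_norm _
    _ ≤ ‖ξ‖ * ‖leftMul τ p ξ‖ := norm_inner_le_norm _ _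
    _ ≤ ‖ξ‖ * (‖p‖ * ‖ξ‖) := by
      gcongr
      exact (leftMul τ p).le_of_opNorm_le (norm_leftMul_le τ p) ξ
    _ = _ := by ring

lemma vecFunctional_mono (ξ : L2 τ) {p q : M} (h : p ≤ q) :
    (vecFunctional τ ξ p).re ≤ (vecFunctional τ ξ q).re :=
  (Complex.le_def.mp (OrderHomClass.mono (vecFunctional τ ξ) h)).1

/-- For invertible `w` the map `x ↦ w* x w` is an order isomorphism, with inverse conjugation by
`w⁻¹`, so it preserves suprema; normality of `τ` does the rest. -/
lemma scottContinuous_vecFunctional_unit (w : Mˣ) :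
    ScottContinuous (vecFunctional τ (vec τ (w : M))) := by
  have hf : ∀ x, vecFunctional τ (vec τ (w : M)) x = τ.toFunctional (star (w : M) * x * w) :=
    fun x => by rw [vecFunctional_apply, leftMul_vec, inner_vec, mul_assoc]
  have hconj : ∀ (v : Mˣ) {x y : M}, x ≤ y → star (v : M) * x * v ≤ star (v : M) * y * v :=
    fun v _ _ h => star_left_conjugate_le_conjugate h _
  have hinv : ∀ x : M, star ((w⁻¹ : Mˣ) : M) * (star (w : M) * x * w) * (w⁻¹ : Mˣ) = x := fun x => by
    have h1 : star ((w⁻¹ : Mˣ) : M) * star (w : M) = 1 := by rw [← star_mul]; simp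
    calc _ = (star ((w⁻¹ : Mˣ) : M) * star (w : M)) * x * ((w : M) * (w⁻¹ : Mˣ)) := by
          noncomm_ring
      _ = x := by rw [h1]; simp
  have hinv' : ∀ x : M, star (w : M) * (star ((w⁻¹ : Mˣ) : M) * x * (w⁻¹ : Mˣ)) * w = x := fun x => by
    have h1 : star (w : M) * star ((w⁻¹ : Mˣ) : M) = 1 := by rw [← star_mul]; simp
    calc _ = (star (w : M) * star ((w⁻¹ : Mˣ) : M)) * x * ((w⁻¹ : Mˣ) * (w : M)) := by
          noncomm_ring
      _ = x := by rw [h1]; simp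
  intro d hd hdir a ha
  have hlub : IsLUB ((fun x => star (w : M) * x * w) '' d) (star (w : M) * a * w) := by
    refine ⟨?_, fun b hb => ?_⟩
    · rintro _ ⟨x, hx, rfl⟩
      exact hconj w (ha.1 hx)
    · have : a ≤ star ((w⁻¹ : Mˣ) : M) * b * (w⁻¹ : Mˣ) := ha.2 fun x hx => by
        have := hconj w⁻¹ (hb ⟨x, hx, rfl⟩)
        rwa [hinv] at this
      have := hconj w this
      rwa [hinv'] at this
  have hdir' : DirectedOn (· ≤ ·) ((fun x => star (w : M) * x * w) '' d) := by
    rintro _ ⟨x, hx, rfl⟩ _ ⟨y, hy, rfl⟩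
    obtain ⟨z, hz, hxz, hyz⟩ := hdir x hx y hy
    exact ⟨_, ⟨z, hz, rfl⟩, hconj w hxz, hconj w hyz⟩
  have := τ.normal (hd.image _) hdir' hlub
  rw [Set.image_image] at this
  simpa only [← hf] using this

lemma scottContinuous_vecFunctional_sub {ξ η : L2 τ} (hξ : ScottContinuous (vecFunctional τ ξ))
    (hη : ScottContinuous (vecFunctional τ η)) : ScottContinuous (vecFunctional τ (ξ - η)) := by
  rw [scottContinuous_iff_exists_lt] at hξ hη ⊢
  intro d hd hdir a ha ε hε
  obtain ⟨x, hx, hx'⟩ := hξ hd hdir ha (ε / 4) (by positivity)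
  obtain ⟨y, hy, hy'⟩ := hη hd hdir ha (ε / 4) (by positivity)
  obtain ⟨z, hz, hxz, hyz⟩ := hdir x hx y hy
  refine ⟨z, hz, ?_⟩
  have h1 := vecFunctional_sub_le τ ξ η (sub_nonneg.mpr (ha.1 hz))
  have h2 := vecFunctional_mono τ ξ (sub_le_sub_left hxz a)
  have h3 := vecFunctional_mono τ η (sub_le_sub_left hyz a)
  linarith

/-- Every element is a difference of two units, `y = c - (c - y)` for a large scalar `c`, which
reduces to the invertible case. -/
lemma scottContinuous_vecFunctional_vec (y : M) : ScottContinuous (vecFunctional τ (vec τ y)) := by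
  let c : ℂ := ((‖y‖ * ‖(1 : M)‖ + 1 : ℝ) : ℂ)
  have hc0 : 0 < ‖y‖ * ‖(1 : M)‖ + 1 := by positivity
  have hc : ‖y‖ * ‖(1 : M)‖ < ‖c‖ := by
    simp only [c, Complex.norm_real, Real.norm_eq_abs, abs_of_pos hc0]
    linarith
  have h1 : IsUnit (algebraMap ℂ M c) := (IsUnit.mk0 c (by
    rw [← norm_pos_iff]; exact lt_of_le_of_lt (by positivity) hc)).map _
  have h2 : IsUnit (algebraMap ℂ M c - y) := spectrum.mem_resolventSet_of_norm_lt_mul hc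
  have e : vec τ y = vec τ (h1.unit : M) - vec τ (h2.unit : M) := by
    rw [← map_sub]; simp
  rw [e]
  exact scottContinuous_vecFunctional_sub τ (scottContinuous_vecFunctional_unit τ _)
    (scottContinuous_vecFunctional_unit τ _)

/-- Vector functionals are normal. -/
lemma scottContinuous_vecFunctional (ξ : L2 τ) : ScottContinuous (vecFunctional τ ξ) := by
  rw [scottContinuous_iff_exists_lt]
  intro d hd hdir a ha ε hε
  obtain ⟨x₀, hx₀⟩ := hd
  obtain ⟨δ, hδ, hδ'⟩ : ∃ δ > 0, 2 * (‖a - x₀‖ * δ ^ 2) < ε / 2 := by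
    have : Tendsto (fun δ : ℝ => 2 * (‖a - x₀‖ * δ ^ 2)) (𝓝[>] 0) (𝓝 (2 * (‖a - x₀‖ * 0 ^ 2))) :=
      (Continuous.tendsto (by fun_prop) 0).mono_left nhdsWithin_le_nhds
    have h := (this.eventually_lt_const (u := ε / 2) (by simp; positivity)).and self_mem_nhdsWithin
    obtain ⟨δ, h1, h2⟩ := h.exists
    exact ⟨δ, h2, h1⟩
  obtain ⟨y, hy⟩ := (denseRange_vec τ).exists_dist_lt ξ hδ
  obtain ⟨x, hx, hx'⟩ := (scottContinuous_iff_exists_lt _).mp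
    (scottContinuous_vecFunctional_vec τ y) ⟨x₀, hx₀⟩ hdir ha (ε / 4) (by positivity)
  -- `z` must dominate `x`, for the estimate at `y Ω`, and the fixed `x₀`, so that `‖a - z‖ ≤ ‖a -
  -- x₀‖` controls the error of replacing `ξ` by `y Ω`.
  obtain ⟨z, hz, hxz, hyz⟩ := hdir x hx x₀ hx₀
  refine ⟨z, hz, ?_⟩
  have hp := sub_nonneg.mpr (ha.1 hz)
  have h1 := vecFunctional_sub_le τ (vec τ y) (vec τ y - ξ) hp
  rw [sub_sub_cancel] at h1
  have h2 := vecFunctional_mono τ (vec τ y) (sub_le_sub_left hxz a)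
  have h3 := vecFunctional_le τ (vec τ y - ξ) (a - z)
  have h4 : ‖a - z‖ ≤ ‖a - x₀‖ :=
    CStarAlgebra.norm_le_norm_of_nonneg_of_le hp (sub_le_sub_left hyz a)
  have h5 : ‖vec τ y - ξ‖ ≤ δ := by rw [← dist_eq_norm, dist_comm]; exact hy.le
  have h6 : ‖a - z‖ * ‖vec τ y - ξ‖ ^ 2 ≤ ‖a - x₀‖ * δ ^ 2 := by gcongr
  linarith

lemma continuous_vecFunctional_sigmaWeak (ξ : L2 τ) :
    @Continuous M ℂ (sigmaWeakTopology M) _ (vecFunctional τ ξ) :=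
  continuous_iff_le_induced.mpr (iInf_le (fun φ : {φ : M →ₚ[ℂ] ℂ // ScottContinuous φ} =>
    TopologicalSpace.induced (fun x => φ.1 x) inferInstance)
    ⟨vecFunctional τ ξ, scottContinuous_vecFunctional τ ξ⟩)

/-- The functionals `x ↦ ⟪ξ, x η⟫` are σ-weakly continuous. -/
lemma continuous_inner_sigmaWeak (ξ η : L2 τ) :
    @Continuous M ℂ (sigmaWeakTopology M) _ fun x => ⟪leftMul τ x ξ, η⟫_ℂ := by
  let _ : TopologicalSpace M := sigmaWeakTopology M
  have h : ∀ ζ : L2 τ, Continuous fun x : M => ⟪leftMul τ x ζ, ζ⟫_ℂ := fun ζ => by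
    have h1 : Continuous fun x : M => starRingEnd ℂ (vecFunctional τ ζ x) :=
      Complex.continuous_conj.comp (continuous_vecFunctional_sigmaWeak τ ζ)
    simpa only [vecFunctional_apply, inner_conj_symm] using h1
  have e : ∀ x : M, ⟪leftMul τ x ξ, η⟫_ℂ = _ := fun x =>
    inner_map_polarization' (leftMul τ x).toLinearMap ξ η
  simp only [e, ContinuousLinearMap.coe_coe]
  exact ((((h _).sub (h _)).sub (continuous_const.mul (h _))).add
    (continuous_const.mul (h _))).div_const _

variable {τ} {Φ : MarkovSemigroup τ} (C : CoreAlgebra Φ)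

/-- `𝒜 Ω` is dense in `L₂(M)`. -/
lemma CoreAlgebra.denseRange_toL2 : DenseRange C.toL2 := by
  suffices h : (LinearMap.range C.toL2).topologicalClosure = ⊤ by
    have := (Submodule.dense_iff_topologicalClosure_eq_top).mpr h
    rwa [LinearMap.coe_range] at this
  rw [Submodule.topologicalClosure_eq_top_iff, Submodule.eq_bot_iff]
  intro ξ hξ
  -- For `ξ` orthogonal to `𝒜 Ω`, this σ-weakly closed set contains `𝒜`, hence is all of `M`; so `ξ`
  -- is orthogonal to `M Ω`.
  have hclosed : @IsClosed M (sigmaWeakTopology M) {x : M | ⟪leftMul τ x (vec τ 1), ξ⟫_ℂ = 0} := by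
    let _ : TopologicalSpace M := sigmaWeakTopology M
    exact isClosed_eq (continuous_inner_sigmaWeak τ _ _) continuous_const
  have hsub : (C.alg : Set M) ⊆ {x : M | ⟪leftMul τ x (vec τ 1), ξ⟫_ℂ = 0} := fun a ha => by
    have := (Submodule.mem_orthogonal _ _).mp hξ (C.toL2 ⟨a, ha⟩) ⟨_, rfl⟩
    simpa using this
  have hall : ∀ x : M, ⟪vec τ x, ξ⟫_ℂ = 0 := fun x => by
    have h := @IsClosed.closure_subset_iff M (sigmaWeakTopology M) _ _ hclosed |>.mpr hsub
      (@Dense.closure_eq M (sigmaWeakTopology M) _ C.dense ▸ Set.mem_univ x)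
    simpa using h
  have : ⟪ξ, ξ⟫_ℂ = 0 := (denseRange_vec τ).induction_on (p := fun ζ => ⟪ζ, ξ⟫_ℂ = 0) ξ
    (isClosed_eq (by fun_prop) continuous_const) hall
  exact inner_self_eq_zero.mp this

end Density

variable {M : Type u} [CStarAlgebra M] [PartialOrder M] [StarOrderedRing M]
  {τ : FaithfulNormalTrace M} {Φ : MarkovSemigroup τ}

namespace CoreAlgebra

variable (C : CoreAlgebra Φ)

/-! ### The trace on the core algebra -/

section Trace

/-- The restriction of the trace to `𝒜`. -/
def trace : C.alg →ₗ[ℂ] ℂ :=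
  τ.toFunctional.toLinearMap ∘ₗ C.alg.toNonUnitalSubalgebra.toSubmodule.subtype

lemma trace_apply (a : C.alg) : C.trace a = τ.toFunctional (a : M) := rfl

lemma trace_mul_comm (a b : C.alg) : C.trace (a * b) = C.trace (b * a) := τ.tracial a b

lemma inner_vec_eq_trace (a b : C.alg) :
    ⟪vec τ (a : M), vec τ (b : M)⟫_ℂ = C.trace (star a * b) := inner_vec τ _ _

/-- The difference quotients already have trace zero, as `Φ_t` preserves `τ`. -/
lemma trace_lap (a : C.alg) : C.trace (C.lap a) = 0 := by
  have h := (tendsto_const_nhds (x := vec τ (1 : M))).inner (C.tendsto_lap a) (𝕜 := ℂ)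
  simp only [inner_vec, star_one, one_mul] at h
  refine tendsto_nhds_unique h (tendsto_const_nhds.congr fun t => ?_)
  rw [map_smul, map_sub, Φ.trace_map, sub_self, smul_zero]

lemma trace_lap_mul (a b : C.alg) : C.trace (C.lap a * b) = C.trace (a * C.lap b) := by
  have h1 := (tendsto_const_nhds (x := vec τ (star (b : M)))).inner (C.tendsto_lap a) (𝕜 := ℂ)
  have h2 := (tendsto_const_nhds (x := vec τ (star (a : M)))).inner (C.tendsto_lap b) (𝕜 := ℂ)
  simp only [inner_vec, star_star] at h1 h2
  rw [trace_mul_comm]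
  refine tendsto_nhds_unique h1 (h2.congr fun t => ?_)
  rw [mul_smul_comm, mul_smul_comm, map_smul, map_smul, mul_sub, mul_sub, map_sub, map_sub,
    ← Φ.symmetric, τ.tracial a b, τ.tracial (Φ.map t a) b]

end Trace

/-! ### Estimates in the gradient space -/

section GradSpace

lemma deriv_apply (a : C.alg) : C.deriv a = C.gtens a (vec τ 1) := rfl

/-- Under the trace the term `Δ(a* b)` of `Γ` vanishes and the other two agree by symmetry of `Δ`,
which absorbs the factor `1/2`. -/
lemma inner_deriv (a b : C.alg) : ⟪C.deriv a, C.deriv b⟫_ℂ = C.trace (star a * C.lap b) := by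
  rw [deriv_apply, deriv_apply, inner_gtens, leftMul_vec, inner_vec, star_one, one_mul, mul_one,
    ← trace_apply, Gam, map_smul, map_sub, map_add, trace_lap, ← lap_star, trace_lap_mul,
    smul_eq_mul]
  ring

lemma norm_gtens_le (x : C.alg) (ξ : L2 τ) :
    ‖C.gtens x ξ‖ ≤ √‖(C.Gam x x : M)‖ * ‖ξ‖ := by
  rw [← sq_le_sq₀ (norm_nonneg _) (by positivity), mul_pow, Real.sq_sqrt (norm_nonneg _)]
  have h1 : ((‖C.gtens x ξ‖ ^ 2 : ℝ) : ℂ) = ⟪ξ, leftMul τ (C.Gam x x : M) ξ⟫_ℂ := by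
    rw [← inner_gtens, inner_self_eq_norm_sq_to_K]; norm_cast
  calc ‖C.gtens x ξ‖ ^ 2 = (vecFunctional τ ξ (C.Gam x x : M)).re := by
        rw [vecFunctional_apply, ← h1, Complex.ofReal_re]
    _ ≤ _ := vecFunctional_le τ ξ _

/-- `‖a · ∂(y)‖² = τ(a* a Γ(y*, y*))`. -/
lemma norm_sq_leftAct_deriv (a y : C.alg) :
    ((‖C.leftAct a (C.deriv y)‖ ^ 2 : ℝ) : ℂ) =
      C.trace (star a * a * C.Gam (star y) (star y)) := by
  have h0 : ((‖C.leftAct a (C.deriv y)‖ ^ 2 : ℝ) : ℂ) =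
      ⟪C.leftAct a (C.deriv y), C.leftAct a (C.deriv y)⟫_ℂ := by
    rw [inner_self_eq_norm_sq_to_K]; norm_cast
  have hcoe : ∀ u v : C.alg, (u : M) * (v : M) = ((u * v : C.alg) : M) := fun _ _ => rfl
  have hstar : ∀ u : C.alg, star (u : M) = ((star u : C.alg) : M) := fun _ => rfl
  rw [h0, deriv_apply, leftAct_gtens, leftMul_vec, mul_one]
  simp only [inner_sub_left, inner_sub_right, inner_gtens, leftMul_vec, inner_vec, star_one, one_mul,
    mul_one, hcoe, hstar, ← trace_apply]
  -- Both sides are combinations of traces of words containing one `Δ`. They are matched by `τ ∘ Δ =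
  -- 0` (`e1`), symmetry of `Δ` (`e2`–`e4`) and cyclicity of the trace (`e5`–`e7`).
  have e1 := C.trace_lap (star (a * y) * (a * y))
  have e2 := C.trace_lap_mul (star (a * y) * a) y
  have e3 := C.trace_lap_mul (star y) (star a * (a * y))
  have e4 := C.trace_lap_mul (star a * a) (y * star y)
  have e5 := C.trace_mul_comm (star y) (C.lap (star a * a) * y)
  have e6 := C.trace_mul_comm (star y) (star a * a * C.lap y)
  have e7 := C.trace_mul_comm (C.lap (star y)) (star a * a * y)
  simp only [Gam, star_mul, star_star, map_smul, mul_smul_comm, smul_mul_assoc, mul_add, mul_sub, add_mul,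
    sub_mul, map_add, map_sub, smul_eq_mul, mul_assoc, ← lap_star] at e1 e2 e3 e4 e5 e6 e7 ⊢
  linear_combination (1 / 2 : ℂ) * (-e1 + e2 - e3 - e4 - e5 + e6 + e7)

/-- `a ↦ a · ∂(y)` is bounded for the norm of `L₂(M)`. -/
lemma norm_leftAct_deriv_le (a y : C.alg) :
    ‖C.leftAct a (C.deriv y)‖ ≤ √‖(C.Gam (star y) (star y) : M)‖ * ‖vec τ (a : M)‖ := by
  rw [← sq_le_sq₀ (norm_nonneg _) (by positivity), mul_pow, Real.sq_sqrt (norm_nonneg _)]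
  have h1 := C.norm_sq_leftAct_deriv a y
  rw [mul_assoc, ← inner_vec_eq_trace] at h1
  calc ‖C.leftAct a (C.deriv y)‖ ^ 2 = ‖((‖C.leftAct a (C.deriv y)‖ ^ 2 : ℝ) : ℂ)‖ := by
        rw [Complex.norm_real, Real.norm_eq_abs, abs_of_nonneg (sq_nonneg _)]
    _ ≤ ‖vec τ (a : M)‖ * ‖vec τ ((a : M) * (C.Gam (star y) (star y) : M))‖ := by
        rw [h1]
        exact norm_inner_le_norm _ _
    _ ≤ ‖vec τ (a : M)‖ * (‖(C.Gam (star y) (star y) : M)‖ * ‖vec τ (a : M)‖) := by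
        gcongr
        exact norm_vec_mul_le τ _ _
    _ = _ := by ring

/-- The Leibniz rule, in the form of a formula for `x · ∂(a) · y`. -/
lemma rightAct_leftAct_deriv (x a y : C.alg) :
    C.rightAct y (C.leftAct x (C.deriv a)) =
      C.deriv (x * a * y) - C.leftAct (x * a) (C.deriv y) - C.gtens x (vec τ ((a : M) * y)) := by
  simp only [deriv_apply, leftAct_gtens, map_sub, rightAct_gtens, leftMul_vec, rightMul_vec, mul_one,
    one_mul]
  abel

end GradSpace

lemma norm_toL2_mul_mul_le (x a y : C.alg) :
    ‖C.toL2 (x * a * y)‖ ≤ ‖(x : M)‖ * ‖(y : M)‖ * ‖C.toL2 a‖ := by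
  have h1 : ‖C.toL2 (x * a)‖ ≤ ‖(x : M)‖ * ‖C.toL2 a‖ := by
    have : C.toL2 (x * a) = leftMul τ (x : M) (C.toL2 a) := by simp
    rw [this]
    exact (leftMul τ (x : M)).le_of_opNorm_le (norm_leftMul_le τ _) _
  calc ‖C.toL2 (x * a * y)‖ ≤ ‖(y : M)‖ * ‖C.toL2 (x * a)‖ := norm_vec_mul_le τ _ _
    _ ≤ ‖(y : M)‖ * (‖(x : M)‖ * ‖C.toL2 a‖) := by gcongr
    _ = _ := by ring

/-! ### The spectral subspaces -/

section Spectral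

lemma mem_specSub_iff {μ : ℝ} {a : C.alg} : a ∈ C.specSub μ ↔ C.lap a = (μ : ℂ) • a := by
  have hv : vec τ (C.lap a : M) = (μ : ℂ) • vec τ (a : M) ↔ C.lap a = (μ : ℂ) • a := by
    rw [← map_smul, (vec_injective τ).eq_iff, Subtype.ext_iff]
    rfl
  rw [← hv, ← C.generator_vec a]
  constructor
  · rintro ⟨d, hd, hda⟩
    have h : d = ⟨vec τ (a : M), C.mem_domain a⟩ := Subtype.ext hda
    subst h
    have := LinearMap.mem_ker.mp hd
    exact sub_eq_zero.mp this
  · intro h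
    exact ⟨⟨vec τ (a : M), C.mem_domain a⟩, LinearMap.mem_ker.mpr (sub_eq_zero.mpr h), rfl⟩

/-- `Δ` commutes with the involution and `μ` is real. This makes the filtration `*`-invariant, which
the lower edge of the band depends on. -/
lemma star_mem_specSub {μ : ℝ} {a : C.alg} (ha : a ∈ C.specSub μ) : star a ∈ C.specSub μ := by
  rw [mem_specSub_iff] at ha ⊢
  rw [lap_star, ha, star_smul]
  simp

lemma inner_eq_zero_of_mem_specSub {μ ν : ℝ} (h : μ ≠ ν) {a b : C.alg} (ha : a ∈ C.specSub μ)
    (hb : b ∈ C.specSub ν) : ⟪C.toL2 a, C.toL2 b⟫_ℂ = 0 := by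
  rw [toL2_apply, toL2_apply, inner_vec_eq_trace]
  have h1 := C.trace_lap_mul (star a) b
  rw [(C.mem_specSub_iff).mp hb, (C.mem_specSub_iff).mp (C.star_mem_specSub ha), smul_mul_assoc,
    mul_smul_comm, map_smul, map_smul, ← sub_eq_zero, ← sub_smul, smul_eq_zero] at h1
  refine h1.resolve_left fun h2 => h ?_
  exact_mod_cast sub_eq_zero.mp h2

/-- On an eigenspace, `⟪∂ a, ∂ a⟫ = λ ⟪a Ω, a Ω⟫`. -/
lemma norm_sq_deriv {μ : ℝ} {a : C.alg} (ha : a ∈ C.specSub μ) :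
    ‖C.deriv a‖ ^ 2 = μ * ‖C.toL2 a‖ ^ 2 := by
  have h := C.inner_deriv a a
  rw [(C.mem_specSub_iff).mp ha, mul_smul_comm, map_smul, ← inner_vec_eq_trace, ← toL2_apply,
    inner_self_eq_norm_sq_to_K, inner_self_eq_norm_sq_to_K] at h
  exact_mod_cast h

lemma inner_deriv_eq_zero {μ ν : ℝ} (h : μ ≠ ν) {a b : C.alg} (ha : a ∈ C.specSub μ)
    (hb : b ∈ C.specSub ν) : ⟪C.deriv a, C.deriv b⟫_ℂ = 0 := by
  have h1 := C.inner_eq_zero_of_mem_specSub h ha hb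
  rw [toL2_apply, toL2_apply, inner_vec_eq_trace] at h1
  rw [C.inner_deriv a b, (C.mem_specSub_iff).mp hb, mul_smul_comm, map_smul, h1, smul_zero]

lemma toL2_injective : Function.Injective C.toL2 := fun _ _ h =>
  Subtype.ext (vec_injective τ h)

variable {C} {lam : ℕ → ℝ}

/-- The filtration of `𝒜` by the spectral subspaces. -/
def fil (C : CoreAlgebra Φ) (lam : ℕ → ℝ) (N : ℕ) :
    Submodule ℂ C.alg := ⨆ k ∈ Finset.range (N + 1), C.specSub (lam k)

lemma specSub_le_fil {k N : ℕ} (hk : k ≤ N) :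
    C.specSub (lam k) ≤ C.fil lam N :=
  le_iSup₂_of_le k (Finset.mem_range.mpr (by omega)) le_rfl

lemma fil_le {N : ℕ} {F : Submodule ℂ C.alg}
    (hF : ∀ k ≤ N, C.specSub (lam k) ≤ F) : C.fil lam N ≤ F :=
  iSup₂_le fun k hk => hF k (by have := Finset.mem_range.mp hk; omega)

lemma star_mem_fil {n : ℕ} {a : C.alg} (ha : a ∈ C.fil lam n) :
    star a ∈ C.fil lam n := by
  obtain ⟨v, rfl⟩ := (Submodule.mem_iSup_finset_iff_exists_sum _ _).mp ha
  rw [star_sum]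
  exact Submodule.sum_mem _ fun k hk => specSub_le_fil
    (by have := Finset.mem_range.mp hk; omega) (C.star_mem_specSub (v k).2)

namespace IsFiltered

variable (h : C.IsFiltered lam)

include h

lemma mem_eigenspace {n : ℕ} {ξ : L2 τ} :
    ξ ∈ Φ.eigenspace (lam n) ↔ ∃ a ∈ C.specSub (lam n), C.toL2 a = ξ := by
  rw [← h.map_specSub n]
  exact Submodule.mem_map

lemma orthogonalFamily :
    OrthogonalFamily ℂ (fun n => Φ.eigenspace (lam n))
      fun n => (Φ.eigenspace (lam n)).subtypeₗᵢ := by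
  rintro m n hmn ⟨ξ, hξ⟩ ⟨η, hη⟩
  obtain ⟨a, ha, rfl⟩ := h.mem_eigenspace.mp hξ
  obtain ⟨b, hb, rfl⟩ := h.mem_eigenspace.mp hη
  exact C.inner_eq_zero_of_mem_specSub (fun e => hmn (h.strictMono.injective e)) ha hb

lemma exists_ne_zero (n : ℕ) : ∃ a ∈ C.specSub (lam n), a ≠ 0 := by
  have hn : Φ.eigenspace (lam n) ≠ ⊥ := by
    have : lam n ∈ Set.range lam := ⟨n, rfl⟩
    rwa [h.range_eq] at this
  obtain ⟨ξ, hξ, h0⟩ := Submodule.exists_mem_ne_zero_of_ne_bot hn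
  obtain ⟨a, ha, rfl⟩ := h.mem_eigenspace.mp hξ
  exact ⟨a, ha, fun e => h0 (by rw [e, map_zero])⟩

/-- A nonzero `a ∈ 𝒜(λ_n)` satisfies `λ_n ‖a Ω‖² = ‖∂ a‖² ≥ 0`. -/
lemma nonneg (n : ℕ) : 0 ≤ lam n := by
  obtain ⟨a, ha, h0⟩ := h.exists_ne_zero n
  have h1 := C.norm_sq_deriv ha
  have h2 : 0 < ‖C.toL2 a‖ ^ 2 := by
    have : C.toL2 a ≠ 0 := (map_ne_zero_iff _ C.toL2_injective).mpr h0
    positivity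
  exact nonneg_of_mul_nonneg_left (h1 ▸ sq_nonneg _) h2

lemma pos {n : ℕ} (hn : 1 ≤ n) : 0 < lam n := (h.nonneg 0).trans_lt (h.strictMono hn)

lemma mul_mem_fil {m n : ℕ} {a b : C.alg} (ha : a ∈ C.fil lam m) (hb : b ∈ C.fil lam n) :
    a * b ∈ C.fil lam (m + n) := by
  refine fil_le (F := (C.fil lam (m + n)).comap (LinearMap.mulRight ℂ b)) (fun k hk x hx => ?_) ha
  refine fil_le (F := (C.fil lam (m + n)).comap (LinearMap.mulLeft ℂ x)) (fun l hl y hy => ?_) hb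
  exact fil_le (fun i hi => specSub_le_fil (by omega)) (h.mul_mem k l x hx y hy)

lemma exists_mem_fil (a : C.alg) : ∃ N, a ∈ C.fil lam N := by
  have ha : a ∈ ⨆ n, C.specSub (lam n) := by
    rw [h.directSum.submodule_iSup_eq_top]
    trivial
  obtain ⟨f, hf, rfl⟩ := (Submodule.mem_iSup_iff_exists_finsupp _ _).mp ha
  exact ⟨f.support.sup id, Submodule.sum_mem _ fun k hk =>
    specSub_le_fil (Finset.le_sup (f := id) hk) (hf k)⟩

lemma inner_fil_eq_zero {m n : ℕ} (hmn : m < n) {u a : C.alg} (hu : u ∈ C.fil lam m)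
    (ha : a ∈ C.specSub (lam n)) : ⟪C.toL2 a, C.toL2 u⟫_ℂ = 0 := by
  refine fil_le (F := LinearMap.ker (innerₛₗ ℂ (C.toL2 a) ∘ₗ C.toL2)) (fun k hk v hv => ?_) hu
  exact C.inner_eq_zero_of_mem_specSub (fun e => (by omega : n ≠ k) (h.strictMono.injective e)) ha hv

/-- Multiplication by elements of the filtration is a band operator. -/
lemma exists_band {m l n : ℕ} {x a y : C.alg} (hx : x ∈ C.fil lam m) (hy : y ∈ C.fil lam l)
    (ha : a ∈ C.specSub (lam n)) (hn : m + l ≤ n) :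
    ∃ u : ℕ → C.alg, (∀ j, u j ∈ C.specSub (lam (n + j - (m + l)))) ∧
      ∑ j ∈ Finset.range (2 * (m + l) + 1), u j = x * a * y := by
  have hmem := h.mul_mem_fil (h.mul_mem_fil hx (specSub_le_fil le_rfl ha)) hy
  obtain ⟨v, hv⟩ := (Submodule.mem_iSup_finset_iff_exists_sum _ _).mp hmem
  -- The lower edge of the band: `⟪x a y, v k⟫ = ⟪a, x* (v k) y*⟫`, and `x* (v k) y*` has degree at
  -- most `m + k + l < n`, so it is orthogonal to `a`.
  have hzero : ∀ k, k + m + l < n → m + n + l + 1 > k → (v k : C.alg) = 0 := by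
    intro k hk hk'
    have h1 : star x * v k * star y ∈ C.fil lam (m + k + l) :=
      h.mul_mem_fil (h.mul_mem_fil (star_mem_fil hx) (specSub_le_fil le_rfl (v k).2))
        (star_mem_fil hy)
    have h2 := h.inner_fil_eq_zero (by omega) h1 ha
    have h3 : ⟪C.toL2 (x * a * y), C.toL2 (v k)⟫_ℂ = 0 := by
      rw [← h2]
      simp only [toL2_apply, inner_vec_eq_trace, star_mul, mul_assoc]
      rw [C.trace_mul_comm]
      simp only [mul_assoc]
    rw [← hv, map_sum, sum_inner, Finset.sum_eq_single k] at h3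
    · exact (map_eq_zero_iff _ C.toL2_injective).mp (inner_self_eq_zero.mp h3)
    · intro i _ hik
      exact C.inner_eq_zero_of_mem_specSub (fun e => hik (h.strictMono.injective e)) (v i).2 (v k).2
    · intro hk2
      exact absurd (Finset.mem_range.mpr hk') hk2
  refine ⟨fun j => v (n + j - (m + l)), fun j => (v _).2, ?_⟩
  rw [← hv, ← Finset.sum_range_add_sum_Ico _ (show n - (m + l) ≤ m + n + l + 1 by omega),
    Finset.sum_eq_zero (s := Finset.range (n - (m + l))), zero_add, Finset.sum_Ico_eq_sum_range]
  · rw [show m + n + l + 1 - (n - (m + l)) = 2 * (m + l) + 1 by omega]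
    refine Finset.sum_congr rfl fun j _ => ?_
    rw [show n - (m + l) + j = n + j - (m + l) by omega]
  · intro k hk
    have := Finset.mem_range.mp hk
    exact hzero k (by omega) (by omega)

end IsFiltered

end Spectral

end CoreAlgebra

/-! ### Consequences of compactness of the resolvent -/

lemma rpow_neg_half {t : ℝ} (ht : 0 ≤ t) : t ^ (-(1 / 2) : ℝ) = (√t)⁻¹ := by
  rw [Real.rpow_neg ht, Real.sqrt_eq_rpow]

namespace MarkovSemigroup

variable (h : Φ.HasCompactResolvent)

include h

/-- The resolvent acts on the eigenspace at `μ` as `(μ - z)⁻¹`. Written without the inverse, the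
relation needs no proof that `μ ≠ z`. -/
lemma HasCompactResolvent.exists_eigenspace :
    ∃ (z : ℂ) (R : L2 τ →L[ℂ] L2 τ), IsCompactOperator R ∧
      ∀ (μ : ℝ), ∀ ξ ∈ Φ.eigenspace μ, ((μ : ℂ) - z) • R ξ = ξ := by
  obtain ⟨z, R, hR, -, hR'⟩ := h
  refine ⟨z, R, hR, ?_⟩
  rintro μ _ ⟨d, hd, rfl⟩
  have h1 : Φ.generator d = (μ : ℂ) • (d : L2 τ) := sub_eq_zero.mp (LinearMap.mem_ker.mp hd)
  have h2 := hR' d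
  rwa [h1, ← sub_smul, map_smul] at h2

/-- The eigenspace is fixed pointwise by the compact operator `(μ - z) R`, whose fixed space has a
compact identity map. -/
lemma HasCompactResolvent.finiteDimensional_eigenspace (μ : ℝ) :
    FiniteDimensional ℂ (Φ.eigenspace μ) := by
  obtain ⟨z, R, hR, hz⟩ := HasCompactResolvent.exists_eigenspace h
  let A : L2 τ →L[ℂ] L2 τ := ((μ : ℂ) - z) • R
  have hA : IsCompactOperator A := hR.smul ((μ : ℂ) - z)
  let V : Submodule ℂ (L2 τ) := LinearMap.ker ((A - 1 : L2 τ →L[ℂ] L2 τ) : L2 τ →ₗ[ℂ] L2 τ)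
  have hV : ∀ v ∈ V, A v = v := fun v hv => sub_eq_zero.mp (LinearMap.mem_ker.mp hv)
  have hVc : IsClosed (V : Set (L2 τ)) := (A - 1).isClosed_ker
  have hVA : ∀ v ∈ V, (A : L2 τ →ₗ[ℂ] L2 τ) v ∈ V := fun v hv => by
    rw [ContinuousLinearMap.coe_coe, hV v hv]; exact hv
  have hid : IsCompactOperator (id : V → V) := by
    have := IsCompactOperator.restrict (f := (A : L2 τ →ₗ[ℂ] L2 τ)) hA hVA hVc
    convert this using 1
    funext v
    exact Subtype.ext (hV v v.2).symm
  have : FiniteDimensional ℂ V := FiniteDimensional.of_isCompactOperator_id hid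
  exact Submodule.finiteDimensional_of_le (S₂ := V) fun ξ hξ =>
    LinearMap.mem_ker.mpr (sub_eq_zero.mpr (hz μ ξ hξ))

end MarkovSemigroup

namespace CoreAlgebra.IsFiltered

variable {C : CoreAlgebra Φ} {lam : ℕ → ℝ} (h : C.IsFiltered lam)

include h

/-- Otherwise `λ_n` converges. For unit eigenvectors `e n = (λ_n - z) R (e n)`, compactness of `R`
then gives a convergent subsequence, which is impossible for orthonormal vectors. -/
lemma tendsto_atTop : Tendsto lam atTop atTop := by
  refine (tendsto_atTop_of_monotone h.strictMono.monotone).resolve_right ?_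
  rintro ⟨l, hl⟩
  obtain ⟨z, R, hR, hz⟩ := MarkovSemigroup.HasCompactResolvent.exists_eigenspace h.compact_resolvent
  have hex : ∀ n, ∃ ξ ∈ Φ.eigenspace (lam n), ‖ξ‖ = 1 := fun n => by
    obtain ⟨a, ha, h0⟩ := h.exists_ne_zero n
    have h1 : C.toL2 a ≠ 0 := (map_ne_zero_iff _ C.toL2_injective).mpr h0
    exact ⟨((‖C.toL2 a‖⁻¹ : ℝ) : ℂ) • C.toL2 a, Submodule.smul_mem _ _ ha, by
      rw [norm_smul, Complex.norm_real, norm_inv, norm_norm,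
        inv_mul_cancel₀ (norm_ne_zero_iff.mpr h1)]⟩
  choose e he he1 using hex
  obtain ⟨K, hK, hRK⟩ := hR.image_closedBall_subset_compact (f := (R : L2 τ →ₗ[ℂ] L2 τ)) 1
  obtain ⟨w, -, φ, hφ, hw⟩ := hK.tendsto_subseq (x := fun n => R (e n))
    fun n => hRK ⟨e n, by simp [he1], rfl⟩
  have hscal : Tendsto (fun k => (lam (φ k) : ℂ) - z) atTop (𝓝 ((l : ℂ) - z)) :=
    ((Complex.continuous_ofReal.tendsto l).comp (hl.comp hφ.tendsto_atTop)).sub_const z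
  have hlim : Tendsto (fun k => e (φ k)) atTop (𝓝 (((l : ℂ) - z) • w)) :=
    (hscal.smul hw).congr fun k => hz _ _ (he _)
  set v := ((l : ℂ) - z) • w
  have hv1 : ‖v‖ = 1 := tendsto_nhds_unique hlim.norm (by simp [he1])
  have hin : Tendsto (fun k => ⟪e (φ k), e (φ (k + 1))⟫_ℂ) atTop (𝓝 ⟪v, v⟫_ℂ) :=
    hlim.inner (hlim.comp (tendsto_add_atTop_nat 1))
  have hzero : ∀ k, ⟪e (φ k), e (φ (k + 1))⟫_ℂ = 0 := fun k =>
    h.orthogonalFamily (hφ (Nat.lt_succ_self k)).ne ⟨_, he _⟩ ⟨_, he _⟩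
  simp only [hzero] at hin
  have hv0 : ⟪v, v⟫_ℂ = 0 := tendsto_nhds_unique hin tendsto_const_nhds
  rw [inner_self_eq_zero.mp hv0, norm_zero] at hv1
  exact zero_ne_one hv1

lemma exists_normalizedDerivation :
    ∃ S : C.alg →ₗ[ℂ] C.GradSpace, C.IsNormalizedDerivation lam S := by
  classical
  let e := LinearEquiv.ofBijective (DirectSum.coeLinearMap fun n => C.specSub (lam n)) h.directSum
  let g : (DirectSum ℕ fun n => C.specSub (lam n)) →ₗ[ℂ] C.GradSpace :=
    DirectSum.toModule ℂ ℕ _ fun n =>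
      -- At a zero eigenvalue the power takes its default value `0`; the value of `S` there is
      -- unconstrained.
      (((lam n) ^ (-(1 / 2) : ℝ) : ℝ) : ℂ) • (C.deriv ∘ₗ (C.specSub (lam n)).subtype)
  refine ⟨g ∘ₗ e.symm.toLinearMap, fun n _ a ha => ?_⟩
  have h1 : e.symm a = DirectSum.lof ℂ ℕ (fun n => C.specSub (lam n)) n ⟨a, ha⟩ := by
    rw [LinearEquiv.symm_apply_eq]
    exact (DirectSum.coeLinearMap_lof (fun n => C.specSub (lam n)) n ⟨a, ha⟩).symm
  change g (e.symm a) = _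
  rw [h1]
  exact DirectSum.toModule_lof ℂ n _

/-- Linear maps on a finite dimensional space are bounded. Used at `n = 0`, this covers the part
where `S` may be arbitrary, without having to decide whether `λ_0 = 0`. -/
lemma exists_bound_specSub (n : ℕ) (S : C.alg →ₗ[ℂ] C.GradSpace) :
    ∃ B : ℝ, 0 ≤ B ∧ ∀ a ∈ C.specSub (lam n), ‖S a‖ ≤ B * ‖C.toL2 a‖ := by
  let e := Submodule.equivMapOfInjective C.toL2 C.toL2_injective (C.specSub (lam n))
  have : FiniteDimensional ℂ ((C.specSub (lam n)).map C.toL2) := by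
    rw [h.map_specSub n]
    exact MarkovSemigroup.HasCompactResolvent.finiteDimensional_eigenspace h.compact_resolvent _
  let g := (S ∘ₗ (C.specSub (lam n)).subtype ∘ₗ e.symm.toLinearMap).toContinuousLinearMap
  refine ⟨‖g‖, g.opNorm_nonneg, fun a ha => ?_⟩
  have h1 := g.le_opNorm (e ⟨a, ha⟩)
  have h2 : g (e ⟨a, ha⟩) = S a := by simp [g]
  rw [h2] at h1
  exact h1

lemma orthogonalFamily_deriv :
    OrthogonalFamily ℂ (fun n => (C.specSub (lam n)).map C.deriv)
      fun n => ((C.specSub (lam n)).map C.deriv).subtypeₗᵢ := by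
  rintro m n hmn ⟨_, a, ha, rfl⟩ ⟨_, b, hb, rfl⟩
  exact C.inner_deriv_eq_zero (fun e => hmn (h.strictMono.injective e)) ha hb

lemma exists_eq_sum (a : C.alg) : ∃ (s : Finset ℕ) (f : ℕ → C.alg),
    (∀ n, f n ∈ C.specSub (lam n)) ∧ a = ∑ n ∈ s, f n := by
  have ha : a ∈ ⨆ n, C.specSub (lam n) := by
    rw [h.directSum.submodule_iSup_eq_top]
    trivial
  obtain ⟨f, hf, rfl⟩ := (Submodule.mem_iSup_iff_exists_finsupp _ _).mp ha
  exact ⟨f.support, f, hf, rfl⟩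

lemma norm_normalizedDerivation {S : C.alg →ₗ[ℂ] C.GradSpace} (hS : C.IsNormalizedDerivation lam S)
    {n : ℕ} (hn : 1 ≤ n) {a : C.alg} (ha : a ∈ C.specSub (lam n)) : ‖S a‖ = ‖C.toL2 a‖ := by
  have hpos := h.pos hn
  rw [← sq_eq_sq₀ (norm_nonneg _) (norm_nonneg _), hS n hpos.ne' a ha, norm_smul, mul_pow,
    C.norm_sq_deriv ha, Complex.norm_real, rpow_neg_half hpos.le, norm_inv, Real.norm_eq_abs,
    inv_pow, sq_abs, Real.sq_sqrt hpos.le, ← mul_assoc, inv_mul_cancel₀ hpos.ne', one_mul]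

/-- On the span of the `𝒜(λ_n)` with `n ≥ 1` the map `S` is isometric: it is so on each summand, and
`∂` keeps the summands orthogonal. The component at `n = 0` contributes the constant `B`. -/
lemma exists_bound {S : C.alg →ₗ[ℂ] C.GradSpace} (hS : C.IsNormalizedDerivation lam S) :
    ∃ B : ℝ, ∀ a, ‖S a‖ ≤ B * ‖C.toL2 a‖ := by
  obtain ⟨B, hB0, hB⟩ := h.exists_bound_specSub 0 S
  refine ⟨B + 1, fun a => ?_⟩
  obtain ⟨s, f, hf, rfl⟩ := h.exists_eq_sum a
  have hE := fun (t : Finset ℕ) =>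
    norm_sq_sum_of_orthogonalFamily h.orthogonalFamily t (a := fun n => C.toL2 (f n)) fun n _ => hf n
  have hpart : ∀ t ⊆ s, ‖C.toL2 (∑ n ∈ t, f n)‖ ≤ ‖C.toL2 (∑ n ∈ s, f n)‖ := fun t ht => by
    rw [← sq_le_sq₀ (norm_nonneg _) (norm_nonneg _), map_sum, map_sum, hE, hE]
    exact Finset.sum_le_sum_of_subset_of_nonneg ht fun _ _ _ => sq_nonneg _
  have h1 : ‖S (∑ n ∈ s with n = 0, f n)‖ ≤ B * ‖C.toL2 (∑ n ∈ s, f n)‖ := by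
    refine (hB _ (Submodule.sum_mem _ fun n hn => ?_)).trans ?_
    · have := (Finset.mem_filter.mp hn).2
      subst this
      exact hf _
    · gcongr
      exact hpart _ (Finset.filter_subset _ _)
  have h2 : ‖S (∑ n ∈ s with ¬ n = 0, f n)‖ ≤ ‖C.toL2 (∑ n ∈ s, f n)‖ := by
    refine le_trans (le_of_eq ?_) (hpart (s.filter fun n => ¬ n = 0) (Finset.filter_subset _ _))
    have hn1 : ∀ n ∈ s.filter (fun n => ¬ n = 0), 1 ≤ n := fun n hn =>
      Nat.one_le_iff_ne_zero.mpr (Finset.mem_filter.mp hn).2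
    rw [← sq_eq_sq₀ (norm_nonneg _) (norm_nonneg _), map_sum, map_sum, hE,
      norm_sq_sum_of_orthogonalFamily h.orthogonalFamily_deriv]
    · exact Finset.sum_congr rfl fun n hn => by
        rw [h.norm_normalizedDerivation hS (hn1 n hn) (hf n)]
    · intro n hn
      rw [hS n (h.pos (hn1 n hn)).ne' _ (hf n)]
      exact Submodule.smul_mem _ _ ⟨f n, hf n, rfl⟩
  calc ‖S (∑ n ∈ s, f n)‖ = ‖S (∑ n ∈ s with n = 0, f n) + S (∑ n ∈ s with ¬ n = 0, f n)‖ := by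
        rw [← map_add, Finset.sum_filter_add_sum_filter_not]
    _ ≤ _ := norm_add_le _ _
    _ ≤ _ := by linarith

lemma dense_iSup_eigenspace :
    Dense ((⨆ n, Φ.eigenspace (lam n) : Submodule ℂ (L2 τ)) : Set (L2 τ)) := by
  refine C.denseRange_toL2.mono ?_
  rintro _ ⟨a, rfl⟩
  obtain ⟨s, f, hf, rfl⟩ := h.exists_eq_sum a
  rw [map_sum]
  exact Submodule.sum_mem _ fun n _ => Submodule.mem_iSup_of_mem n (hf n)

end CoreAlgebra.IsFiltered

/-! ### Subexponential growth -/

namespace CoreAlgebra.SubexponentialGrowth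

lemma tendsto_div_add {lam : ℕ → ℝ} (hpos : ∀ n, 1 ≤ n → 0 < lam n) (hg : SubexponentialGrowth lam)
    (j : ℕ) : Tendsto (fun n => lam (n + j) / lam n) atTop (𝓝 1) := by
  induction j with
  | zero =>
    refine tendsto_const_nhds.congr' ?_
    filter_upwards [eventually_ge_atTop 1] with n hn
    exact (div_self (hpos n hn).ne').symm
  | succ j ih =>
    have h1 := (hg.comp (tendsto_add_atTop_nat j)).mul ih
    rw [mul_one] at h1
    refine h1.congr' ?_
    filter_upwards [eventually_ge_atTop 1] with n hn
    exact div_mul_div_cancel₀ (hpos (n + j) (by omega)).ne'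

/-- After the shift `n ↦ n + L` the quotient is `(λ_{n+j} / λ_n) / (λ_{n+L} / λ_n)`, and the
truncated subtraction disappears. -/
lemma tendsto_div_band {lam : ℕ → ℝ} (hpos : ∀ n, 1 ≤ n → 0 < lam n)
    (hg : SubexponentialGrowth lam) (L j : ℕ) :
    Tendsto (fun n => lam (n + j - L) / lam n) atTop (𝓝 1) := by
  have h1 := (tendsto_div_add hpos hg j).div (tendsto_div_add hpos hg L) one_ne_zero
  rw [div_one] at h1
  refine (tendsto_add_atTop_iff_nat L).mp (h1.congr' ?_)
  filter_upwards [eventually_ge_atTop 1] with n hn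
  rw [show n + L + j - L = n + j by omega]
  exact div_div_div_cancel_right₀ (hpos n hn).ne' _ _

/-- Within a band of fixed width the quotients `(λ_k / λ_n)^{1/2}` are close to `1`. -/
lemma eventually_band {lam : ℕ → ℝ} (hpos : ∀ n, 1 ≤ n → 0 < lam n)
    (hg : SubexponentialGrowth lam) (L : ℕ) {δ : ℝ} (hδ : 0 < δ) :
    ∀ᶠ n in atTop, ∀ j ∈ Finset.range (2 * L + 1),
      |(√(lam n))⁻¹ * √(lam (n + j - L)) - 1| ≤ δ := by
  rw [Filter.eventually_all_finset]
  intro j _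
  have h1 := (Real.continuous_sqrt.tendsto 1).comp (tendsto_div_band hpos hg L j)
  rw [Real.sqrt_one] at h1
  filter_upwards [(Metric.tendsto_nhds.mp h1) δ hδ, eventually_ge_atTop (L + 1)] with n hn hnL
  rw [Function.comp_apply, Real.dist_eq, Real.sqrt_div (hpos _ (by omega)).le, div_eq_inv_mul] at hn
  exact hn.le

end CoreAlgebra.SubexponentialGrowth

/-! ### Compactness of the commutators -/

namespace CoreAlgebra.IsFiltered

variable {C : CoreAlgebra Φ} {lam : ℕ → ℝ} (h : C.IsFiltered lam)

include h

lemma deriv_eq_smul {S : C.alg →ₗ[ℂ] C.GradSpace} (hS : C.IsNormalizedDerivation lam S)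
    {n : ℕ} (hn : 1 ≤ n) {a : C.alg} (ha : a ∈ C.specSub (lam n)) :
    C.deriv a = ((√(lam n) : ℝ) : ℂ) • S a := by
  have hpos := h.pos hn
  rw [hS n hpos.ne' a ha, smul_smul, rpow_neg_half hpos.le, ← Complex.ofReal_mul,
    mul_inv_cancel₀ (Real.sqrt_pos.mpr hpos).ne', Complex.ofReal_one, one_smul]

/-- The difference of `λ_n^{-1/2} ∂(x a_n y)` and `S(x a_n y)`, in terms of the components of
`x a_n y`. -/
lemma exists_deriv_sub_eq {S : C.alg →ₗ[ℂ] C.GradSpace} (hS : C.IsNormalizedDerivation lam S)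
    {m l n : ℕ} {x a y : C.alg} (hx : x ∈ C.fil lam m) (hy : y ∈ C.fil lam l)
    (ha : a ∈ C.specSub (lam n)) (hn : m + l < n) {δ : ℝ}
    (hδ : ∀ j ∈ Finset.range (2 * (m + l) + 1),
      |(√(lam n))⁻¹ * √(lam (n + j - (m + l))) - 1| ≤ δ) :
    ∃ w : ℕ → C.alg, (∀ j, w j ∈ C.specSub (lam (n + j - (m + l)))) ∧
      (∀ j ∈ Finset.range (2 * (m + l) + 1),
        ‖C.toL2 (w j)‖ ≤ δ * (‖(x : M)‖ * ‖(y : M)‖) * ‖C.toL2 a‖) ∧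
      (((lam n) ^ (-(1 / 2) : ℝ) : ℝ) : ℂ) • C.deriv (x * a * y) - S (x * a * y) =
        ∑ j ∈ Finset.range (2 * (m + l) + 1), S (w j) := by
  obtain ⟨u, hu, hsum⟩ := h.exists_band hx hy ha hn.le
  have hinj : Function.Injective fun j => n + j - (m + l) := fun i j hij => by
    simp only at hij
    omega
  -- The components are orthogonal, so each is no longer than `x a y` itself.
  have hle : ∀ j ∈ Finset.range (2 * (m + l) + 1),
      ‖C.toL2 (u j)‖ ≤ ‖(x : M)‖ * ‖(y : M)‖ * ‖C.toL2 a‖ := fun j hj => by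
    refine le_trans ?_ (C.norm_toL2_mul_mul_le x a y)
    rw [← sq_le_sq₀ (norm_nonneg _) (norm_nonneg _), ← hsum, map_sum,
      norm_sq_sum_of_orthogonalFamily (E := fun j => Φ.eigenspace (lam (n + j - (m + l))))
        (h.orthogonalFamily.comp hinj) _ fun j _ => hu j]
    exact Finset.single_le_sum (f := fun j => ‖C.toL2 (u j)‖ ^ 2) (fun _ _ => sq_nonneg _) hj
  -- The scalar comes from `∂ (u j) = √λ_k • S (u j)` with `k = n + j - (m + l)`; the strict
  -- inequality `m + l < n` ensures `k ≥ 1`.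
  refine ⟨fun j => (((√(lam n))⁻¹ * √(lam (n + j - (m + l))) - 1 : ℝ) : ℂ) • u j,
    fun j => Submodule.smul_mem _ _ (hu j), fun j hj => ?_, ?_⟩
  · rw [map_smul, norm_smul, Complex.norm_real, mul_assoc]
    have h1 := hδ j hj
    exact mul_le_mul h1 (hle j hj) (norm_nonneg _) ((abs_nonneg _).trans h1)
  · rw [← hsum, map_sum, map_sum, Finset.smul_sum, ← Finset.sum_sub_distrib]
    refine Finset.sum_congr rfl fun j _ => ?_
    rw [h.deriv_eq_smul hS (by omega) (hu j), rpow_neg_half (h.nonneg n), map_smul, smul_smul,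
      ← Complex.ofReal_mul, Complex.ofReal_sub, sub_smul, Complex.ofReal_one, one_smul]

/-- `T_{x,y}` is small on the orthogonal complement of finitely many eigenspaces. -/
lemma commOp_tail (hg : SubexponentialGrowth lam) {S : C.alg →ₗ[ℂ] C.GradSpace}
    (hS : C.IsNormalizedDerivation lam S) {S' : L2 τ →L[ℂ] C.GradSpace}
    (hS' : ∀ a, S' (C.toL2 a) = S a) (x y : C.alg) {ε : ℝ} (hε : 0 < ε) :
    ∃ N : ℕ, ∀ s : Finset ℕ, (∀ n ∈ s, N ≤ n) → ∀ b : ℕ → C.alg, (∀ n, b n ∈ C.specSub (lam n)) →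
      ‖C.commOp S' x y (C.toL2 (∑ n ∈ s, b n))‖ ≤ ε * ‖C.toL2 (∑ n ∈ s, b n)‖ := by
  obtain ⟨m, hx⟩ := h.exists_mem_fil x
  obtain ⟨l, hy⟩ := h.exists_mem_fil y
  set L := m + l with hL
  set K : ℝ := ‖(x : M)‖ * ‖(y : M)‖ with hK
  -- `c₁` is the constant of the band term and `c₂` that of the two terms controlled by `‖B Ω‖`;
  -- each gets half of `ε`. The `+ 1` in `δ` and `η` avoids division by zero.
  set c₁ : ℝ := ‖S'‖ * ((2 * L + 1 : ℕ) * K)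
  set c₂ : ℝ := √‖(C.Gam (star y) (star y) : M)‖ * ‖(x : M)‖ + √‖(C.Gam x x : M)‖ * ‖(y : M)‖
  have hc₁ : 0 ≤ c₁ := by positivity
  have hc₂ : 0 ≤ c₂ := by positivity
  set δ : ℝ := ε / 2 / (c₁ + 1)
  set η : ℝ := ε / 2 / (c₂ + 1)
  have hδ : 0 < δ := by positivity
  have hη : 0 < η := by positivity
  have hδε : c₁ * δ ≤ ε / 2 := by
    have : (c₁ + 1) * δ = ε / 2 := mul_div_cancel₀ _ (by positivity)
    nlinarith
  have hηε : c₂ * η ≤ ε / 2 := by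
    have : (c₂ + 1) * η = ε / 2 := mul_div_cancel₀ _ (by positivity)
    nlinarith
  have hlim : Tendsto (fun n => (√(lam n))⁻¹) atTop (𝓝 0) :=
    tendsto_inv_atTop_zero.comp (Real.tendsto_sqrt_atTop.comp h.tendsto_atTop)
  obtain ⟨N, hN⟩ := eventually_atTop.mp ((SubexponentialGrowth.eventually_band
    (fun n hn => h.pos hn) hg L hδ).and ((hlim.eventually_lt_const hη).and
      (eventually_ge_atTop (L + 1))))
  refine ⟨N, fun s hs b hb => ?_⟩
  have hsL : ∀ n ∈ s, L + 1 ≤ n := fun n hn => (hN n (hs n hn)).2.2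
  set r : ℕ → ℂ := fun n => (((lam n) ^ (-(1 / 2) : ℝ) : ℝ) : ℂ) with hr
  have hrn : ∀ n ∈ s, ‖r n‖ ≤ η := fun n hn => by
    rw [hr, Complex.norm_real, rpow_neg_half (h.nonneg n), Real.norm_eq_abs,
      abs_of_nonneg (by positivity)]
    exact (hN n (hs n hn)).2.1.le
  set a : C.alg := ∑ n ∈ s, b n with ha
  set B : C.alg := ∑ n ∈ s, r n • b n with hB
  have hSa : S a = C.deriv B := by
    rw [ha, hB, map_sum, map_sum]
    exact Finset.sum_congr rfl fun n hn => by
      rw [map_smul, hS n (h.pos (by have := hsL n hn; omega)).ne' _ (hb n)]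
  have hBnorm : ‖C.toL2 B‖ ≤ η * ‖C.toL2 a‖ := by
    rw [ha, hB, map_sum, map_sum]
    simp only [map_smul]
    exact norm_sum_smul_le h.orthogonalFamily s (fun n _ => hb n) hη.le hrn
  -- The membership `n ∈ s` sits inside the existential so that `choose` yields a `w` defined for
  -- all `n`.
  have hex : ∀ n, ∃ w : ℕ → C.alg, n ∈ s → (∀ j, w j ∈ C.specSub (lam (n + j - L))) ∧
      (∀ j ∈ Finset.range (2 * L + 1), ‖C.toL2 (w j)‖ ≤ δ * K * ‖C.toL2 (b n)‖) ∧
      r n • C.deriv (x * b n * y) - S (x * b n * y) =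
        ∑ j ∈ Finset.range (2 * L + 1), S (w j) := fun n => by
    by_cases hn : n ∈ s
    · obtain ⟨w, hw⟩ := h.exists_deriv_sub_eq hS hx hy (hb n) (hsL n hn) (hN n (hs n hn)).1
      exact ⟨w, fun _ => hw⟩
    · exact ⟨0, fun h => absurd h hn⟩
  choose w hw using hex
  have hband : ‖C.deriv (x * B * y) - S (x * a * y)‖ ≤ c₁ * δ * ‖C.toL2 a‖ := by
    have e1 : C.deriv (x * B * y) - S (x * a * y) =
        S' (∑ n ∈ s, ∑ j ∈ Finset.range (2 * L + 1), C.toL2 (w n j)) := by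
      simp only [map_sum, hS']
      rw [ha, hB, Finset.mul_sum, Finset.mul_sum, Finset.sum_mul, Finset.sum_mul, map_sum, map_sum,
        ← Finset.sum_sub_distrib]
      refine Finset.sum_congr rfl fun n hn => ?_
      rw [← (hw n hn).2.2, mul_smul_comm, smul_mul_assoc, map_smul]
    have h1 := norm_band_sum_le h.orthogonalFamily L s (fun n hn => by have := hsL n hn; omega)
      (a := fun n => C.toL2 (b n)) (fun n _ => hb n) (fun n j => C.toL2 (w n j))
      (fun n hn j => (hw n hn).1 j) (r := δ * K) (by positivity) (fun n hn => (hw n hn).2.1)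
    rw [e1]
    refine (S'.le_opNorm_of_le h1).trans (le_of_eq ?_)
    rw [ha, map_sum]
    ring
  have hleft : ‖C.leftAct (x * B) (C.deriv y)‖ ≤
      √‖(C.Gam (star y) (star y) : M)‖ * (‖(x : M)‖ * (η * ‖C.toL2 a‖)) := by
    refine (C.norm_leftAct_deriv_le _ _).trans ?_
    gcongr
    have : vec τ ((x * B : C.alg) : M) = leftMul τ (x : M) (C.toL2 B) := by simp
    rw [this]
    exact ((leftMul τ (x : M)).le_of_opNorm_le_of_le (norm_leftMul_le τ _) hBnorm)
  have hright : ‖C.gtens x (vec τ ((B : M) * y))‖ ≤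
      √‖(C.Gam x x : M)‖ * (‖(y : M)‖ * (η * ‖C.toL2 a‖)) := by
    refine (C.norm_gtens_le _ _).trans ?_
    gcongr
    refine (norm_vec_mul_le τ _ _).trans ?_
    gcongr
    exact hBnorm
  -- The Leibniz formula applied to `x · ∂(B) · y`, separating the band term from the two terms that
  -- gain the factor `η`.
  have e : C.commOp S' x y (C.toL2 a) = C.deriv (x * B * y) - S (x * a * y) -
      C.leftAct (x * B) (C.deriv y) - C.gtens x (vec τ ((B : M) * y)) := by
    have e1 : leftMul τ (x : M) (rightMul τ (y : M) (C.toL2 a)) = C.toL2 (x * a * y) := by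
      simp [mul_assoc]
    change C.rightAct y (C.leftAct x (S' (C.toL2 a))) -
      S' (leftMul τ (x : M) (rightMul τ (y : M) (C.toL2 a))) = _
    rw [e1, hS', hS', hSa, C.rightAct_leftAct_deriv]
    abel
  rw [e]
  calc _ ≤ ‖C.deriv (x * B * y) - S (x * a * y)‖ + ‖C.leftAct (x * B) (C.deriv y)‖ +
        ‖C.gtens x (vec τ ((B : M) * y))‖ :=
        (norm_sub_le _ _).trans (add_le_add_left (norm_sub_le _ _) _)
    _ ≤ c₁ * δ * ‖C.toL2 a‖ + √‖(C.Gam (star y) (star y) : M)‖ * (‖(x : M)‖ * (η * ‖C.toL2 a‖)) +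
        √‖(C.Gam x x : M)‖ * (‖(y : M)‖ * (η * ‖C.toL2 a‖)) := by gcongr
    _ = (c₁ * δ + c₂ * η) * ‖C.toL2 a‖ := by ring
    _ ≤ (ε / 2 + ε / 2) * ‖C.toL2 a‖ := by gcongr
    _ = ε * ‖C.toL2 a‖ := by rw [add_halves]

lemma isCompactOperator_commOp (hg : SubexponentialGrowth lam) {S : C.alg →ₗ[ℂ] C.GradSpace}
    (hS : C.IsNormalizedDerivation lam S) {S' : L2 τ →L[ℂ] C.GradSpace}
    (hS' : ∀ a, S' (C.toL2 a) = S a) (x y : C.alg) : IsCompactOperator (C.commOp S' x y) := by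
  refine isCompactOperator_of_tail h.orthogonalFamily
    (fun n => MarkovSemigroup.HasCompactResolvent.finiteDimensional_eigenspace
      h.compact_resolvent _) h.dense_iSup_eigenspace _ fun ε hε => ?_
  obtain ⟨N, hN⟩ := h.commOp_tail hg hS hS' x y hε
  refine ⟨N, fun s hs a ha => ?_⟩
  choose b hb hba using fun n => h.mem_eigenspace.mp (ha n)
  have := hN s hs b hb
  simpa only [map_sum, hba] using this

end CoreAlgebra.IsFiltered

end QuantumMarkov

end

theorem mainTheorem5 {M : Type*} [CStarAlgebra M] [PartialOrder M] [StarOrderedRing M]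
    [WStarAlgebra M] {τ : QuantumMarkov.FaithfulNormalTrace M}
    {Φ : QuantumMarkov.MarkovSemigroup τ} (C : QuantumMarkov.CoreAlgebra Φ) (lam : ℕ → ℝ)
    (hfiltered : C.IsFiltered lam)
    (hgrowth : QuantumMarkov.CoreAlgebra.SubexponentialGrowth lam) :
    (∃ S : C.alg →ₗ[ℂ] C.GradSpace, C.IsNormalizedDerivation lam S) ∧
      ∀ S : C.alg →ₗ[ℂ] C.GradSpace, C.IsNormalizedDerivation lam S →
        ∃ S' : QuantumMarkov.L2 τ →L[ℂ] C.GradSpace,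
          (∀ a : C.alg, S' (C.toL2 a) = S a) ∧
            ∀ x y : C.alg, IsCompactOperator (C.commOp S' x y) := by
  refine ⟨hfiltered.exists_normalizedDerivation, fun S hS => ?_⟩
  have hS' := LinearMap.extendOfNorm_eq C.denseRange_toL2 (hfiltered.exists_bound hS)
  exact ⟨_, hS', hfiltered.isCompactOperator_commOp hgrowth hS hS'⟩
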